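/- All graphs are finite. An undirected graph $G=(X,E)$ is *distance-hereditary* if for every connected induced subgraph $H$ of $G$ and all vertices $x,y$ of $H$ one has $d_H(x,y)=d_G(x,y)$. A *network* $N$ is a finite directed acyclic graph whose underlying undirected graph is connected, such that every vertex of indegree $0$ has outdegree at least $2$, every vertex of outdegree $0$ (a *leaf*) has indegree $1$, and no vertex has both indegree $1$ and outdegree $1$. It is *arboreal* if its underlying undirected graph is a tree. A vertex $u$ is an *ancestor* of $v$ if there is a directed path (possibly of length $0$) from $u$ to $v$. A *least common ancestor* of two leaves $x,y$ is a vertex that is an ancestor of both, none of whose children is an ancestor of both; in an arboreal network, two distinct leaves $x,y$ that have a common ancestor have a unique least common ancestor $\operatorname{lca}_N(x,y)$, and it has outdegree at least $2$. A *labelled arboreal network* $(N,t)$ is an arboreal network $N$ with a map $t$ from the set of vertices of outdegree at least $2$ to $\{0,1\}$. A graph $G=(X,E)$ is *arboreal-explainable* if there is a labelled arboreal network $(N,t)$ with leaf set $X$ such that two distinct $x,y\in X$ are adjacent in $G$ if and only if they share an ancestor in $N$ and $t(\operatorname{lca}_N(x,y))=1$. **Theorem.** Let $G=(X,E)$ be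 an undirected graph with $|X|\ge 2$. Then $G$ is arboreal-explainable if and only if $G$ is distance-hereditary. -/

import Mathlib

universe u

/-- A graph is distance-hereditary if every connected induced subgraph `G[s]` preserves the
distances of `G` between its vertices.  (Two vertices of such a subgraph are connected in `G`,
so both distances are genuine lengths of shortest paths.) -/
def SimpleGraph.IsDistanceHereditary {X : Type u} (G : SimpleGraph X) : Prop :=
  ∀ s : Set X, (G.induce s).Connected → ∀ x y : s, G.dist x y = (G.induce s).dist x y

namespace Digraph

variable {V : Type u} (N : Digraph V)

/-- The number of parents of `v`. -/
noncomputable def indeg (v : V) : ℕ := {u | N.Adj u v}.ncard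

/-- The number of children of `v`. -/
noncomputable def outdeg (v : V) : ℕ := {w | N.Adj v w}.ncard

/-- `u` is an ancestor of `v`: there is a directed path, possibly of length zero,
from `u` to `v`. -/
def IsAncestor (u v : V) : Prop := Relation.ReflTransGen N.Adj u v

/-- No directed closed walk of positive length; in particular no loops and no pairs of
opposite arcs. -/
def IsAcyclic : Prop := ∀ v, ¬ Relation.TransGen N.Adj v v

/-- A network: a connected directed acyclic graph in which roots have outdegree at least two,
leaves have indegree one, and no vertex has both indegree one and outdegree one.
(Finiteness of the vertex set is imposed where networks are quantified over.) -/
structure IsNetwork : Prop where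
  connected : N.toSimpleGraphInclusive.Connected
  acyclic : N.IsAcyclic
  two_le_outdeg_of_root : ∀ v, N.indeg v = 0 → 2 ≤ N.outdeg v
  indeg_of_leaf : ∀ v, N.outdeg v = 0 → N.indeg v = 1
  not_one_one : ∀ v, ¬ (N.indeg v = 1 ∧ N.outdeg v = 1)

/-- An arboreal network: a network whose underlying undirected graph is a tree. -/
structure IsArborealNetwork : Prop extends N.IsNetwork where
  isTree : N.toSimpleGraphInclusive.IsTree

/-- The set of leaves, that is, of vertices without children. -/
def leaves : Set V := {v | N.outdeg v = 0}

/-- The set of vertices with at least two children. -/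
def branching : Set V := {v | 2 ≤ N.outdeg v}

/-- `x` and `y` share an ancestor. -/
def ShareAncestor (x y : V) : Prop := ∃ u, N.IsAncestor u x ∧ N.IsAncestor u y

/-- `u` is a least common ancestor of `x` and `y`: it is an ancestor of both, and none of its
children is. -/
def IsLCA (u x y : V) : Prop :=
  (N.IsAncestor u x ∧ N.IsAncestor u y) ∧
    ∀ c, N.Adj u c → ¬ (N.IsAncestor c x ∧ N.IsAncestor c y)

/-- `u` is the unique least common ancestor of `x` and `y`. -/
def IsUniqueLCA (u x y : V) : Prop :=
  N.IsLCA u x y ∧ ∀ w, N.IsLCA w x y → w = u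

theorem ShareAncestor.symm {N : Digraph V} {x y : V} (h : N.ShareAncestor x y) :
    N.ShareAncestor y x :=
  h.imp fun _ hu => hu.symm

theorem IsLCA.symm {N : Digraph V} {u x y : V} (h : N.IsLCA u x y) : N.IsLCA u y x :=
  ⟨h.1.symm, fun c hc hxy => h.2 c hc hxy.symm⟩

theorem IsUniqueLCA.symm {N : Digraph V} {u x y : V} (h : N.IsUniqueLCA u x y) :
    N.IsUniqueLCA u y x :=
  ⟨h.1.symm, fun w hw => h.2 w hw.symm⟩

/-- The undirected graph on the leaves of `N` induced by a labelling `t` of the branching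
vertices: two distinct leaves are adjacent if and only if they share an ancestor and their
unique least common ancestor has label `1`. -/
def explainedGraph (t : N.branching → Fin 2) : SimpleGraph N.leaves where
  Adj x y := x ≠ y ∧ N.ShareAncestor x y ∧
    ∃ u : N.branching, N.IsUniqueLCA (u : V) x y ∧ t u = 1
  symm := ⟨fun _ _ h => ⟨h.1.symm, h.2.1.symm, h.2.2.imp fun _ hu => ⟨hu.1.symm, hu.2⟩⟩⟩
  loopless := ⟨fun _ h => h.1 rfl⟩

end Digraph

/-- `G` is arboreal-explainable if, up to identifying the vertices of `G` with leaves, it is the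
graph induced by some finite labelled arboreal network. -/
def SimpleGraph.IsArborealExplainable {X : Type u} (G : SimpleGraph X) : Prop :=
  ∃ (V : Type u) (_ : Finite V) (N : Digraph V) (t : N.branching → Fin 2),
    N.IsArborealNetwork ∧ Nonempty (G ≃g N.explainedGraph t)

namespace SimpleGraph

/-! Both directions go through the dismantling of distance-hereditary graphs by twins and vertices
of degree at most one (Bandelt and Mulder). Distance-heredity is used in the form
`IsWalkHereditary`, which speaks only of walks in `G`; it passes to induced subgraphs
(`IsWalkHereditary.of_embedding`) and survives adding a twin or pendant vertex
(`IsWalkHereditary.of_isTwinOrPendant`).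

From networks to graphs, `lcaGraph` extends the explained graph to all vertices of the network, with
arbitrary labels and no degree conditions. This makes induction on the tree possible: near a vertex
whose neighbours, except possibly one, are leaves of the underlying tree, some vertex is a twin of
another or has at most one neighbour (`isWalkHereditary_lcaGraph`). The explained graph is an
induced subgraph.

From graphs to networks, `IsWalkHereditary.exists_isTwinOrPendant` finds `x` and `y` such that `y`
is a twin of `x` or has no neighbour besides possibly `x`. A network for the graph without `y` is
then modified at the leaf `l` of `x`. For twins, `l` receives two leaf children, for `x` and `y`.
Otherwise `l` receives one leaf child for `x` and an additional parent, a new root whose other child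
is the leaf of `y`; so `y` shares an ancestor with no leaf other than that of `x`. In both cases one
new label decides whether `x` and `y` are adjacent. -/

/-- Any walk can be replaced by a walk through its own vertices that is no longer than any other
prescribed walk between the same endpoints. -/
def IsWalkHereditary {X : Type*} (G : SimpleGraph X) : Prop :=
  ∀ ⦃a b : X⦄ (p q : G.Walk a b), ∃ r : G.Walk a b, r.support ⊆ p.support ∧ r.length ≤ q.length

/-! ### Walk-hereditary graphs and the addition of twins and pendant vertices -/

section WalkHereditary

variable {X Y : Type*} {G : SimpleGraph X} {H : SimpleGraph Y}

theorem Walk.exists_weakMap (f : X → Y) (hf : ∀ a b, G.Adj a b → f a = f b ∨ H.Adj (f a) (f b))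
    {a b : X} (p : G.Walk a b) :
    ∃ q : H.Walk (f a) (f b), q.length ≤ p.length ∧ ∀ z ∈ q.support, ∃ w ∈ p.support, f w = z := by
  induction p with
  | nil => exact ⟨.nil, by simp, by simp⟩
  | @cons a c b h p ih =>
    obtain ⟨q, hl, hs⟩ := ih
    rcases hf a c h with he | he
    · refine ⟨q.copy he.symm rfl, by simp; omega, fun z hz => ?_⟩
      obtain ⟨w, hw, rfl⟩ := hs z (by simpa using hz)
      exact ⟨w, by simp [hw], rfl⟩
    · refine ⟨.cons he q, by simpa using hl, fun z hz => ?_⟩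
      rcases List.mem_cons.1 (by simpa using hz) with rfl | hz
      · exact ⟨a, by simp, rfl⟩
      · obtain ⟨w, hw, rfl⟩ := hs z hz
        exact ⟨w, by simp [hw], rfl⟩

theorem Walk.exists_of_induce {s : Set X} {x y : s} (r : (G.induce s).Walk x y) :
    ∃ q : G.Walk (x : X) y, q.length = r.length ∧ ∀ z ∈ q.support, z ∈ s := by
  induction r with
  | @nil u => exact ⟨.nil, rfl, by simp⟩
  | @cons a c b h p ih =>
    obtain ⟨q, hl, hs⟩ := ih
    have h' : G.Adj (a : X) c := h
    exact ⟨.cons h' q, by simp [hl], by simpa using hs⟩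

theorem Walk.exists_induce {s : Set X} {x y : X} (r : G.Walk x y) (hs : ∀ z ∈ r.support, z ∈ s)
    (hx : x ∈ s) (hy : y ∈ s) :
    ∃ q : (G.induce s).Walk ⟨x, hx⟩ ⟨y, hy⟩, q.length = r.length := by
  induction r with
  | nil => exact ⟨.nil, rfl⟩
  | @cons a c b h p ih =>
    obtain ⟨q, hl⟩ := ih (fun z hz => hs z (by simp [hz])) (hs c (by simp)) hy
    have h' : (G.induce s).Adj ⟨a, hx⟩ ⟨c, hs c (by simp)⟩ := h
    exact ⟨.cons h' q, by simp [hl]⟩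

/-- Project both walks along `f`, which does not lengthen them, shorten in `H`, and return along
`g`. Only the length of `q` matters, so `g ∘ f` has to preserve the support of `p` alone. -/
theorem IsWalkHereditary.exists_walk_of_retract (hH : H.IsWalkHereditary) (f : X → Y) (g : H →g G)
    (hf : ∀ a b, G.Adj a b → f a = f b ∨ H.Adj (f a) (f b)) {a b : X} (p q : G.Walk a b)
    (ha : g (f a) = a) (hb : g (f b) = b) (hp : ∀ z ∈ p.support, g (f z) ∈ p.support) :
    ∃ r : G.Walk a b, r.support ⊆ p.support ∧ r.length ≤ q.length := by
  obtain ⟨p', -, hp'⟩ := p.exists_weakMap f hf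
  obtain ⟨q', hq', -⟩ := q.exists_weakMap f hf
  obtain ⟨r, hr, hl⟩ := hH p' q'
  refine ⟨(r.map g).copy ha hb, fun z hz => ?_, by simp; omega⟩
  obtain ⟨w, hw, rfl⟩ : ∃ w ∈ r.support, g w = z := by simpa using hz
  obtain ⟨v, hv, rfl⟩ := hp' w (hr hw)
  exact hp v hv

theorem IsWalkHereditary.of_embedding (f : H ↪g G) (hG : G.IsWalkHereditary) :
    H.IsWalkHereditary := by
  intro a b p q
  obtain ⟨r, hr, hl⟩ := hG (p.map f.toHom) (q.map f.toHom)
  have key : ∀ {c d : X} (r : G.Walk c d) (a b : Y) (ha : f a = c) (hb : f b = d),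
      (∀ z ∈ r.support, ∃ w ∈ p.support, f w = z) →
      ∃ s : H.Walk a b, s.support ⊆ p.support ∧ s.length = r.length := by
    intro c d r
    induction r with
    | @nil c =>
      intro a b ha hb h
      obtain rfl : a = b := f.injective (ha.trans hb.symm)
      obtain ⟨w, hw, he⟩ := h c (by simp)
      obtain rfl : w = a := f.injective (he.trans ha.symm)
      exact ⟨.nil, by simpa using hw, rfl⟩
    | @cons c e d hce r ih =>
      intro a b ha hb h
      obtain ⟨w, hw, rfl⟩ := h e (by simp)
      obtain ⟨s, hs, hl⟩ := ih w b rfl hb fun z hz => h z (by simp [hz])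
      obtain ⟨v, hv, he⟩ := h c (by simp)
      obtain rfl : v = a := f.injective (he.trans ha.symm)
      refine ⟨.cons (f.map_adj_iff.1 (by rw [ha]; exact hce)) s, ?_, by simp [hl]⟩
      intro z hz
      rcases List.mem_cons.1 (by simpa using hz) with rfl | hz
      · exact hv
      · exact hs hz
  obtain ⟨s, hs, hsl⟩ := key r a b rfl rfl fun z hz => by simpa using hr hz
  exact ⟨s, hs, by simpa [hsl] using hl⟩

/-- The support of a walk induces a connected subgraph, and in a connected induced subgraph any two
vertices are joined by a walk; `q` stands for a shortest walk of `G`. -/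
theorem isDistanceHereditary_iff_isWalkHereditary {X : Type u} {G : SimpleGraph X} :
    G.IsDistanceHereditary ↔ G.IsWalkHereditary := by
  constructor
  · intro h a b p q
    have hc := p.connected_induce_support
    obtain ⟨r, hr⟩ := hc.exists_walk_length_eq_dist ⟨a, p.start_mem_support⟩ ⟨b, p.end_mem_support⟩
    obtain ⟨r', hl, hs⟩ := r.exists_of_induce
    refine ⟨r', hs, ?_⟩
    rw [hl, hr, ← h _ hc]
    exact dist_le q
  · intro h s hs x y
    obtain ⟨p, hp⟩ := hs.exists_walk_length_eq_dist x y
    obtain ⟨p', hl, hps⟩ := p.exists_of_induce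
    obtain ⟨q, hq⟩ := p'.reachable.exists_walk_length_eq_dist
    obtain ⟨r, hr, hrl⟩ := h p' q
    obtain ⟨r', hr'⟩ := r.exists_induce (fun z hz => hps z (hr hz)) x.2 y.2
    apply le_antisymm
    · rw [← hp, ← hl]
      exact dist_le p'
    · rw [← hq]
      exact (dist_le r').trans (hr'.trans_le hrl)

/-- `y` is a twin of `x`, or has no neighbour other than `x`. -/
def IsTwinOrPendant (G : SimpleGraph X) (x y : X) : Prop :=
  (∀ z, z ≠ x → z ≠ y → (G.Adj y z ↔ G.Adj x z)) ∨ ∀ z, z ≠ x → ¬ G.Adj y z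

-- Folding `y` onto `x` is a retraction onto the graph without `y`. It settles every walk avoiding
-- `y` as an endpoint that meets `x` whenever it meets `y`; the remaining walks are treated by
-- symmetry or by hand.
open Classical in
theorem IsWalkHereditary.of_isTwinOrPendant {x y : X} (hxy : x ≠ y) (h : G.IsTwinOrPendant x y)
    (hG : (G.induce {y}ᶜ).IsWalkHereditary) : G.IsWalkHereditary := by
  set f : X → ({y}ᶜ : Set X) := fun z => if hz : z = y then ⟨x, hxy⟩ else ⟨z, hz⟩ with hf
  have fy : f y = ⟨x, hxy⟩ := by simp [hf]
  have fz : ∀ z (hz : z ≠ y), f z = ⟨z, hz⟩ := fun z hz => by simp [hf, hz]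
  have hadj : ∀ a b, G.Adj a b → f a = f b ∨ (G.induce {y}ᶜ).Adj (f a) (f b) := by
    intro a b hab
    have key : ∀ b, G.Adj y b → f y = f b ∨ (G.induce {y}ᶜ).Adj (f y) (f b) := by
      intro b hb
      rw [fy, fz b hb.ne']
      by_cases hbx : b = x
      · left; simp [hbx]
      · right
        rcases h with h | h
        · exact (h b hbx hb.ne').1 hb
        · exact absurd hb (h b hbx)
    by_cases ha : a = y
    · subst ha; exact key b hab
    by_cases hb : b = y
    · subst hb; exact (key a hab.symm).imp Eq.symm fun h => h.symm
    · right; rw [fz a ha, fz b hb]; exact hab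
  have main : ∀ {a b : X} (p q : G.Walk a b), a ≠ y → b ≠ y → (y ∈ p.support → x ∈ p.support) →
      ∃ r : G.Walk a b, r.support ⊆ p.support ∧ r.length ≤ q.length := by
    intro a b p q ha hb hp
    refine hG.exists_walk_of_retract f (Embedding.induce _).toHom hadj p q ?_ ?_ fun z hz => ?_
    · rw [fz a ha]; rfl
    · rw [fz b hb]; rfl
    · by_cases hzy : z = y
      · subst hzy; rw [fy]; exact hp hz
      · rw [fz z hzy]; exact hz
  intro a b p q
  rcases h with h | h
  -- Since `x` and `y` are twins, the graph without `y` also maps into `G` with `y` in the role of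
  -- `x`.
  · let g : G.induce {y}ᶜ →g G :=
      { toFun := fun z => if (z : X) = x then y else z
        map_rel' := by
          rintro ⟨c, hc⟩ ⟨d, hd⟩ hcd
          change G.Adj c d at hcd
          change G.Adj (if c = x then y else c) (if d = x then y else d)
          by_cases hcx : c = x
          · subst hcx
            rw [if_pos rfl, if_neg hcd.ne']
            exact (h d hcd.ne' hd).2 hcd
          · rw [if_neg hcx]
            split_ifs with hdx
            · subst hdx
              exact ((h c hcd.ne hc).2 hcd.symm).symm
            · exact hcd }
    have gx : ∀ z, z ≠ x → g (f z) = z := by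
      intro z hz
      change (if ((f z : ({y}ᶜ : Set X)) : X) = x then y else (f z : X)) = z
      by_cases hzy : z = y
      · subst hzy; simp [fy]
      · simp [fz z hzy, hz]
    have gy : g (f x) = y := by
      change (if ((f x : ({y}ᶜ : Set X)) : X) = x then y else (f x : X)) = y
      simp [fz x hxy]
    have hxy2 : ∀ {x y : X} (p q : G.Walk x y), x ≠ y →
        (∀ z, z ≠ x → z ≠ y → (G.Adj y z ↔ G.Adj x z)) →
        ∃ r : G.Walk x y, r.support ⊆ p.support ∧ r.length ≤ q.length := by
      intro x y p q hxy h
      by_cases ha : G.Adj x y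
      · refine ⟨.cons ha .nil, by simp, ?_⟩
        cases q with
        | nil => exact absurd rfl hxy
        | cons => simp
      · cases p with
        | nil => exact absurd rfl hxy
        | @cons _ c _ hc p =>
          have hcy : c ≠ y := by rintro rfl; exact ha hc
          have hyc := (h c hc.ne' hcy).2 hc
          refine ⟨.cons hc (.cons hyc.symm .nil), by simp, ?_⟩
          cases q with
          | nil => exact absurd rfl hxy
          | cons h1 q =>
            cases q with
            | nil => exact absurd h1 ha
            | cons => simp
    by_cases h1 : a ≠ y ∧ b ≠ y ∧ (y ∈ p.support → x ∈ p.support)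
    · exact main p q h1.1 h1.2.1 h1.2.2
    by_cases h2 : a ≠ x ∧ b ≠ x ∧ (x ∈ p.support → y ∈ p.support)
    · refine hG.exists_walk_of_retract f g hadj p q (gx a h2.1) (gx b h2.2.1) fun z hz => ?_
      by_cases hzx : z = x
      · subst hzx; rw [gy]; exact h2.2.2 hz
      · rwa [gx z hzx]
    have ha := p.start_mem_support
    have hb := p.end_mem_support
    -- If neither `x` nor `y` can be folded away, both must be endpoints of the walk.
    have : (a = x ∧ b = y) ∨ (a = y ∧ b = x) := by grind
    rcases this with ⟨rfl, rfl⟩ | ⟨rfl, rfl⟩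
    · exact hxy2 p q hxy h
    · exact hxy2 p q hxy.symm fun z h1 h2 => (h z h2 h1).symm
  · have nb : ∀ z, G.Adj y z → z = x := fun z hz => by
      by_contra hzx; exact h z hzx hz
    have hmem : ∀ {a b : X} (p : G.Walk a b), a ≠ y → y ∈ p.support → x ∈ p.support := by
      intro a b p
      induction p with
      | nil => intro h1 h2; simp at h2; exact absurd h2.symm h1
      | @cons a c b hac p ih =>
        intro h1 h2
        by_cases hc : c = y
        · subst hc; simp [nb a hac.symm]
        · have : y ∈ p.support := by
            rcases List.mem_cons.1 (by simpa using h2) with h2 | h2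
            · exact absurd h2.symm h1
            · exact h2
          simp [ih hc this]
    -- Both walks leave `y` through its only possible neighbour `x`, so the first edge is stripped
    -- from each.
    have half : ∀ {b : X} (p q : G.Walk y b), b ≠ y →
        ∃ r : G.Walk y b, r.support ⊆ p.support ∧ r.length ≤ q.length := by
      intro b p q hb
      cases p with
      | nil => exact absurd rfl hb
      | @cons _ c _ hc p =>
        cases q with
        | nil => exact absurd rfl hb
        | @cons _ d _ hd q =>
          obtain rfl := nb c hc
          obtain rfl := nb d hd
          obtain ⟨r, hr, hl⟩ := main p q hxy hb (hmem p hxy)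
          refine ⟨.cons hc r, ?_, by simpa using hl⟩
          intro z hz
          rcases List.mem_cons.1 (by simpa using hz) with rfl | hz
          · simp
          · simp [hr hz]
    by_cases ha : a = y
    · subst ha
      by_cases hb : b = a
      · subst hb; exact ⟨.nil, by simp, by simp⟩
      · exact half p q hb
    · by_cases hb : b = y
      · subst hb
        obtain ⟨r, hr, hl⟩ := half p.reverse q.reverse ha
        exact ⟨r.reverse, by simpa using hr, by simpa using hl⟩
      · exact main p q ha hb (hmem p ha)

end WalkHereditary

end SimpleGraph

namespace SimpleGraph

/-! ### Sets without an induced path on four vertices, and their twins -/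

section Cograph

variable {X : Type*} {G : SimpleGraph X} {S : Set X}

/-- No four vertices of `S` induce a path. -/
def P4FreeOn (G : SimpleGraph X) (S : Set X) : Prop :=
  ∀ a ∈ S, ∀ b ∈ S, ∀ c ∈ S, ∀ d ∈ S, G.Adj a b → G.Adj b c → G.Adj c d →
    ¬ G.Adj a c → ¬ G.Adj b d → ¬ G.Adj a d → False

/-- `S` is the disjoint union of two nonempty parts that are either completely joined or
without edges between them. -/
def SplitsOn (G : SimpleGraph X) (S : Set X) : Prop :=
  ∃ A : Set X, (S ∩ A).Nonempty ∧ (S \ A).Nonempty ∧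
    ((∀ a ∈ S ∩ A, ∀ b ∈ S \ A, G.Adj a b) ∨ ∀ a ∈ S ∩ A, ∀ b ∈ S \ A, ¬ G.Adj a b)

theorem P4FreeOn.mono {T : Set X} (h : G.P4FreeOn S) (hT : T ⊆ S) : G.P4FreeOn T :=
  fun a ha b hb c hc d hd => h a (hT ha) b (hT hb) c (hT hc) d (hT hd)

theorem P4FreeOn.compl (h : G.P4FreeOn S) : Gᶜ.P4FreeOn S := by
  intro a ha b hb c hc d hd hab hbc hcd hac hbd had
  simp only [compl_adj, not_and, not_not] at *
  have h1 : a ≠ c := by rintro rfl; exact hcd.2 (had hcd.1)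
  have h2 : b ≠ d := by rintro rfl; exact hab.2 (had hab.1)
  have h3 : a ≠ d := by rintro rfl; exact hab.2 (hbd hab.1.symm).symm
  -- The path on four vertices is self-complementary: `a b c d` becomes `b d a c`.
  exact h b hb d hd a ha c hc (hbd h2) (had h3).symm (hac h1) (fun h => hab.2 h.symm)
    (fun h => hcd.2 h.symm) hbc.2

theorem SplitsOn.of_compl (h : Gᶜ.SplitsOn S) : G.SplitsOn S := by
  obtain ⟨A, h1, h2, h3 | h3⟩ := h
  · exact ⟨A, h1, h2, Or.inr fun a ha b hb => ((compl_adj ..).1 (h3 a ha b hb)).2⟩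
  · refine ⟨A, h1, h2, Or.inl fun a ha b hb => ?_⟩
    by_contra hn
    exact h3 a ha b hb ((compl_adj ..).2 ⟨fun e => hb.2 (e ▸ ha.2), hn⟩)

/-- If `v` misses one side, that side splits off; if `v` sees all of `S`, it is joined to `S`.
Otherwise the non-neighbours of `v` split off: an edge from a non-neighbour `z` to a neighbour `w`
stays on one side, and a neighbour `e` of `v` on the other side yields the induced path `e v w z`.
-/
theorem SplitsOn.insert_of_not_adj {v : X} (hv : v ∉ S) (hP : G.P4FreeOn (insert v S)) {A : Set X}
    (hA : (S ∩ A).Nonempty) (hB : (S \ A).Nonempty)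
    (hAB : ∀ a ∈ S ∩ A, ∀ b ∈ S \ A, ¬ G.Adj a b) : G.SplitsOn (insert v S) := by
  by_cases h1 : ∃ a ∈ S ∩ A, G.Adj v a
  swap
  · push Not at h1
    obtain ⟨a, ha⟩ := hA
    refine ⟨S ∩ A, ⟨a, Or.inr ha.1, ha⟩, ⟨v, Or.inl rfl, fun h => hv h.1⟩, Or.inr ?_⟩
    rintro a ⟨-, ha⟩ b ⟨rfl | hb, hb'⟩ hab
    · exact h1 a ha hab.symm
    · exact hAB a ha b ⟨hb, fun h => hb' ⟨hb, h⟩⟩ hab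
  by_cases h2 : ∃ b ∈ S \ A, G.Adj v b
  swap
  · push Not at h2
    obtain ⟨a, ha⟩ := hB
    refine ⟨S \ A, ⟨a, Or.inr ha.1, ha⟩, ⟨v, Or.inl rfl, fun h => hv h.1⟩, Or.inr ?_⟩
    rintro a ⟨-, ha⟩ b ⟨rfl | hb, hb'⟩ hab
    · exact h2 a ha hab.symm
    · exact hAB b ⟨hb, by by_contra h; exact hb' ⟨hb, h⟩⟩ a ha hab.symm
  obtain ⟨a, ha, hva⟩ := h1
  obtain ⟨b, hb, hvb⟩ := h2
  by_cases h3 : ∃ z ∈ S, ¬ G.Adj v z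
  · obtain ⟨z, hz, hvz⟩ := h3
    refine ⟨{z | z ∈ S ∧ ¬ G.Adj v z}, ⟨z, Or.inr hz, hz, hvz⟩, ⟨v, Or.inl rfl, fun h => hv h.1⟩,
      Or.inr ?_⟩
    rintro z ⟨-, hz, hvz⟩ w ⟨rfl | hw, hw'⟩ hzw
    · exact hvz hzw.symm
    · have hvw : G.Adj v w := by by_contra h; exact hw' ⟨hw, h⟩
      have key : ∀ e ∈ S, G.Adj v e → ¬ G.Adj e w → ¬ G.Adj e z → False :=
        fun e he hve h1 h2 => hP e (Or.inr he) v (Or.inl rfl) w (Or.inr hw) z (Or.inr hz)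
          hve.symm hvw hzw.symm h1 hvz h2
      by_cases hzA : z ∈ A <;> by_cases hwA : w ∈ A
      · exact key b hb.1 hvb (fun h => hAB w ⟨hw, hwA⟩ b hb h.symm)
          fun h => hAB z ⟨hz, hzA⟩ b hb h.symm
      · exact hAB z ⟨hz, hzA⟩ w ⟨hw, hwA⟩ hzw
      · exact hAB w ⟨hw, hwA⟩ z ⟨hz, hzA⟩ hzw.symm
      · exact key a ha.1 hva (hAB a ha w ⟨hw, hwA⟩) (hAB a ha z ⟨hz, hzA⟩)
  · push Not at h3
    refine ⟨{v}, ⟨v, Or.inl rfl, rfl⟩, ⟨a, Or.inr ha.1, hva.ne'⟩, Or.inl ?_⟩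
    rintro _ ⟨-, rfl⟩ w ⟨rfl | hw, hw'⟩
    · exact absurd rfl hw'
    · exact h3 w hw

theorem P4FreeOn.splitsOn (hf : S.Finite) : S.Nontrivial → G.P4FreeOn S → G.SplitsOn S := by
  induction S, hf using Set.Finite.induction_on with
  | empty => intro h; simp at h
  | @insert v S hv _ ih =>
    intro hn hP
    by_cases hS : S.Nontrivial
    · obtain ⟨A, hA, hB, h | h⟩ := ih hS (hP.mono (Set.subset_insert _ _))
      · refine SplitsOn.of_compl (SplitsOn.insert_of_not_adj hv hP.compl hA hB fun a ha b hb h' => ?_)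
        exact ((compl_adj ..).1 h').2 (h a ha b hb)
      · exact SplitsOn.insert_of_not_adj hv hP hA hB h
    · rw [Set.not_nontrivial_iff] at hS
      rcases hS.eq_empty_or_singleton with rfl | ⟨s, rfl⟩
      · simp at hn
      · have hsv : s ≠ v := fun h => hv h.symm
        refine ⟨{v}, ⟨v, by simp⟩, ⟨s, by simp, hsv⟩, ?_⟩
        by_cases h : G.Adj v s
        · left
          rintro _ ⟨-, rfl⟩ b ⟨rfl | rfl, hb⟩
          · exact absurd rfl hb
          · exact h
        · right
          rintro _ ⟨-, rfl⟩ b ⟨rfl | rfl, hb⟩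
          · exact absurd rfl hb
          · exact h

/-- Recurse into a part of the split with at least two vertices: the other part does not distinguish
its vertices. If both parts are singletons, their elements are twins relative to `S`. -/
theorem P4FreeOn.exists_twins [Finite X] (hn : S.Nontrivial) (hP : G.P4FreeOn S) :
    ∃ x ∈ S, ∃ y ∈ S, x ≠ y ∧ ∀ z ∈ S, z ≠ x → z ≠ y → (G.Adj y z ↔ G.Adj x z) := by
  induction hk : S.ncard using Nat.strong_induction_on generalizing S with
  | _ k ih =>
    obtain ⟨A, hA, hB, h⟩ := hP.splitsOn S.toFinite hn
    have lift : ∀ T U : Set X, T ⊆ S → U.Nonempty → U ⊆ S → Disjoint T U → S ⊆ T ∪ U →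
        T.Nontrivial →
        ((∀ a ∈ T, ∀ b ∈ U, G.Adj a b) ∨ ∀ a ∈ T, ∀ b ∈ U, ¬ G.Adj a b) →
        ∃ x ∈ S, ∃ y ∈ S, x ≠ y ∧ ∀ z ∈ S, z ≠ x → z ≠ y → (G.Adj y z ↔ G.Adj x z) := by
      intro T U hT hUn hU hd hTU hTn h
      have hlt : T.ncard < k := by
        rw [← hk]
        refine Set.ncard_lt_ncard ⟨hT, fun h => ?_⟩
        obtain ⟨w, hw⟩ := hUn
        exact Set.disjoint_left.1 hd (h (hU hw)) hw
      obtain ⟨x, hx, y, hy, hxy, hz⟩ := ih _ hlt hTn (hP.mono hT) rfl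
      refine ⟨x, hT hx, y, hT hy, hxy, fun z hzS h1 h2 => ?_⟩
      rcases hTU hzS with hzT | hzU
      · exact hz z hzT h1 h2
      · rcases h with h | h
        · exact iff_of_true (h y hy z hzU) (h x hx z hzU)
        · exact iff_of_false (h y hy z hzU) (h x hx z hzU)
    have hdis : Disjoint (S ∩ A) (S \ A) := Set.disjoint_left.2 fun a h1 h2 => h2.2 h1.2
    have hun : S ⊆ (S ∩ A) ∪ (S \ A) := fun z hz => by
      by_cases h : z ∈ A
      · exact Or.inl ⟨hz, h⟩
      · exact Or.inr ⟨hz, h⟩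
    by_cases h1 : (S ∩ A).Nontrivial
    · exact lift _ _ Set.inter_subset_left hB Set.sdiff_subset hdis hun h1 h
    by_cases h2 : (S \ A).Nontrivial
    · refine lift _ _ Set.sdiff_subset hA Set.inter_subset_left hdis.symm
        (hun.trans (Set.union_comm _ _).subset) h2 ?_
      exact h.imp (fun h a ha b hb => (h b hb a ha).symm) fun h a ha b hb h' => h b hb a ha h'.symm
    rw [Set.not_nontrivial_iff] at h1 h2
    obtain ⟨a, ha⟩ := hA
    obtain ⟨b, hb⟩ := hB
    refine ⟨a, ha.1, b, hb.1, fun e => hb.2 (e ▸ ha.2), fun z hz h3 h4 => ?_⟩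
    rcases hun hz with h | h
    · exact absurd (h1 h ha) h3
    · exact absurd (h2 h hb) h4

/-- By `hS` the set is a module, so twins inside it are twins in the whole graph. -/
theorem P4FreeOn.exists_isTwinOrPendant [Finite X] (hn : S.Nontrivial) (hP : G.P4FreeOn S)
    (hS : ∀ a ∈ S, ∀ b ∈ S, ∀ z ∉ S, G.Adj a z → G.Adj b z) :
    ∃ x y, x ≠ y ∧ G.IsTwinOrPendant x y := by
  obtain ⟨x, hx, y, hy, hxy, h⟩ := hP.exists_twins hn
  refine ⟨x, y, hxy, Or.inl fun z h1 h2 => ?_⟩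
  by_cases hz : z ∈ S
  · exact h z hz h1 h2
  · exact ⟨hS y hy x hx z hz, hS x hx y hy z hz⟩

end Cograph

/-! ### Distance levels and the existence of a twin or pendant vertex -/

section Levels

variable {X : Type*} {G : SimpleGraph X}

theorem IsWalkHereditary.exists_common_neighbor_mem (hG : G.IsWalkHereditary) {a b c : X}
    (hab : a ≠ b) (hn : ¬ G.Adj a b) (hac : G.Adj a c) (hcb : G.Adj c b) (p : G.Walk a b) :
    ∃ m ∈ p.support, G.Adj a m ∧ G.Adj m b := by
  obtain ⟨r, hr, hl⟩ := hG p (.cons hac (.cons hcb .nil))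
  cases r with
  | nil => exact absurd rfl hab
  | @cons _ m _ h1 r =>
    cases r with
    | nil => exact absurd h1 hn
    | @cons _ m' _ h2 r =>
      cases r with
      | nil => exact ⟨m, hr (by simp), h1, h2⟩
      | cons => simp at hl

/-- The ends of an induced path on four vertices would be at distance two through `c`, while the
path itself contains no common neighbour of its ends. -/
theorem IsWalkHereditary.p4FreeOn_of_common_neighbor (hG : G.IsWalkHereditary) {S : Set X} {c : X}
    (hc : ∀ s ∈ S, G.Adj c s) : G.P4FreeOn S := by
  intro x hx y hy z hz w hw hxy hyz hzw hxz hyw hxw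
  have hne : x ≠ w := by rintro rfl; exact hxz hzw.symm
  obtain ⟨m, hm, h1, h2⟩ := hG.exists_common_neighbor_mem hne hxw (hc x hx).symm (hc w hw)
    (.cons hxy (.cons hyz (.cons hzw .nil)))
  simp only [Walk.support_cons, Walk.support_nil, List.mem_cons, List.not_mem_nil, or_false] at hm
  rcases hm with rfl | rfl | rfl | rfl
  · exact h1.ne rfl
  · exact hyw h2
  · exact hxz h1
  · exact h2.ne rfl

theorem IsWalkHereditary.exists_adj_closer (hG : G.IsWalkHereditary) {u y : X} (hy : y ≠ u)
    (p : G.Walk u y) : ∃ m ∈ p.support, G.Adj m y ∧ G.dist u m + 1 = G.dist u y := by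
  obtain ⟨q, hq⟩ := p.reachable.exists_walk_length_eq_dist
  obtain ⟨r, hr, hl⟩ := hG p q
  have hnil : ¬ r.Nil := fun h => hy h.eq.symm
  have hadj := r.adj_penultimate hnil
  refine ⟨r.penultimate, hr (r.getVert_mem_support _), hadj, ?_⟩
  have h1 := dist_le r.dropLast
  have h2 : r.dropLast.length + 1 = r.length := by
    have := congrArg Walk.length (r.concat_dropLast hadj)
    rwa [Walk.length_concat] at this
  have h3 := hadj.diff_dist_adj (u := u)
  omega

theorem Reachable.exists_geodesic {u v : X} (h : G.Reachable u v) :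
    ∃ p : G.Walk u v, ∀ z ∈ p.support, z = v ∨ G.dist u z < G.dist u v := by
  classical
  obtain ⟨p, hp⟩ := h.exists_walk_length_eq_dist
  refine ⟨p, fun z hz => ?_⟩
  by_cases hzv : z = v
  · exact Or.inl hzv
  · right
    have := p.length_takeUntil_lt_length hz hzv
    have := dist_le (p.takeUntil z hz)
    omega

/-- Follow a geodesic from `u` to `p`, then the edge to `x`, then `q`. Some vertex of this walk is a
neighbour of `y` one level closer to `u`, and `p` is the only vertex of the walk on that level. -/
theorem IsWalkHereditary.adj_of_walk_above (hG : G.IsWalkHereditary) {u x y p : X}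
    (hup : G.Reachable u p) (hpx : G.Adj p x) (hd : G.dist u p + 1 = G.dist u x)
    (hxy : G.dist u y = G.dist u x) (q : G.Walk x y)
    (hq : ∀ z ∈ q.support, G.dist u x ≤ G.dist u z) : G.Adj p y := by
  obtain ⟨g, hg⟩ := hup.exists_geodesic
  have hy : y ≠ u := by rintro rfl; simp at hxy; omega
  obtain ⟨m, hm, hmy, hmd⟩ := hG.exists_adj_closer hy (g.append (.cons hpx q))
  rw [Walk.mem_support_append_iff] at hm
  rcases hm with hm | hm
  · rcases hg m hm with rfl | h
    · exact hmy
    · omega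
  · rcases List.mem_cons.1 (by simpa using hm) with rfl | hm
    · exact hmy
    · have := hq m hm
      omega

/-- First `a` and `b` are nonadjacent, by the walk `v a b w`. Then the walk `a v q w b` forces `q`
to be adjacent to `a` and `b`. Now `v` and `b` have the common neighbour `q`, but the walk `v a c b`
contains none. -/
theorem IsWalkHereditary.not_crossing (hG : G.IsWalkHereditary) {v w q a b c : X}
    (hvw : ¬ G.Adj v w) (hvq : G.Adj v q) (hwq : G.Adj w q) (hva : G.Adj v a) (hwa : ¬ G.Adj w a)
    (hwb : G.Adj w b) (hvb : ¬ G.Adj v b) (hca : G.Adj c a) (hcb : G.Adj c b)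
    (hcv : ¬ G.Adj c v) : False := by
  have hne : v ≠ w := by rintro rfl; exact hwa hva
  have hab : a ≠ b := by rintro rfl; exact hwa hwb
  have hvb' : v ≠ b := by rintro rfl; exact hvw hwb.symm
  have nab : ¬ G.Adj a b := by
    intro h
    obtain ⟨m, hm, h1, h2⟩ := hG.exists_common_neighbor_mem hne hvw hvq hwq.symm
      (.cons hva (.cons h (.cons hwb.symm .nil)))
    simp only [Walk.support_cons, Walk.support_nil, List.mem_cons, List.not_mem_nil, or_false] at hm
    rcases hm with rfl | rfl | rfl | rfl
    · exact h1.ne rfl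
    · exact hwa h2.symm
    · exact hvb h1
    · exact h2.ne rfl
  obtain ⟨m, hm, h1, h2⟩ := hG.exists_common_neighbor_mem hab nab hca.symm hcb
    (.cons hva.symm (.cons hvq (.cons hwq.symm (.cons hwb .nil))))
  simp only [Walk.support_cons, Walk.support_nil, List.mem_cons, List.not_mem_nil, or_false] at hm
  have : m = q := by
    rcases hm with rfl | rfl | rfl | rfl | rfl
    · exact absurd rfl h1.ne
    · exact absurd h2 hvb
    · rfl
    · exact absurd h1.symm hwa
    · exact absurd rfl h2.ne
  subst this
  obtain ⟨n, hn, h3, h4⟩ := hG.exists_common_neighbor_mem hvb' hvb hvq h2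
    (.cons hva (.cons hca.symm (.cons hcb .nil)))
  simp only [Walk.support_cons, Walk.support_nil, List.mem_cons, List.not_mem_nil, or_false] at hn
  rcases hn with rfl | rfl | rfl | rfl
  · exact h3.ne rfl
  · exact nab h4
  · exact hcv h3.symm
  · exact h4.ne rfl

/-- The argument looks for a module without induced four-vertex paths in or just before the last
distance level `L` from `u`: either a class of vertices of `L` with equal neighbourhoods one level
closer, or the neighbourhood of a vertex of `L` of minimum degree. -/
theorem IsWalkHereditary.exists_isTwinOrPendant [Finite X] [Nontrivial X]
    (hG : G.IsWalkHereditary) : ∃ x y, x ≠ y ∧ G.IsTwinOrPendant x y := by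
  obtain ⟨u⟩ : Nonempty X := inferInstance
  by_cases hu : ∃ z, G.Adj u z
  swap
  · push Not at hu
    obtain ⟨x, hx⟩ := exists_ne u
    exact ⟨x, u, hx, Or.inr fun z _ => hu z⟩
  obtain ⟨w, hw⟩ := hu
  obtain ⟨v₀, hv₀, hmax⟩ := Set.exists_max_image {z | G.Reachable u z} (G.dist u) (Set.toFinite _)
    ⟨u, Reachable.refl u⟩
  obtain ⟨k, hk⟩ : ∃ k, k = G.dist u v₀ := ⟨_, rfl⟩
  have hk1 : 1 ≤ k := by
    rw [hk, ← dist_eq_one_iff_adj.2 hw]; exact hmax w hw.reachable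
  replace hmax : ∀ z, G.Reachable u z → G.dist u z ≤ k := fun z hz => hk ▸ hmax z hz
  set L : Set X := {z | G.Reachable u z ∧ G.dist u z = k} with hL
  have hnbr : ∀ a ∈ L, ∀ z, G.Adj a z → G.Reachable u z ∧ (G.dist u z = k ∨ G.dist u z + 1 = k) := by
    rintro a ⟨ha, hak⟩ z haz
    have hr := ha.trans haz.reachable
    have := hmax z hr
    have := haz.diff_dist_adj (u := u)
    exact ⟨hr, by omega⟩
  have hsame : ∀ a ∈ L, ∀ b ∈ L, G.Adj a b → ∀ p, G.dist u p + 1 = k → G.Adj p a → G.Adj p b := by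
    rintro a ⟨ha, hak⟩ b ⟨hb, hbk⟩ hab p hp hpa
    refine hG.adj_of_walk_above (ha.trans hpa.symm.reachable) hpa (by omega) (by omega)
      (.cons hab .nil) ?_
    simp [hak, hbk]
  -- For `k = 1` the variable `p` also ranges over other components, where `dist` is 0; such `p`
  -- have no neighbour in `L`, so they are harmless.
  by_cases hA : ∃ x ∈ L, ∃ y ∈ L, x ≠ y ∧ ∀ p, G.dist u p + 1 = k → (G.Adj p x ↔ G.Adj p y)
  · obtain ⟨x, hx, y, hy, hxy, hxyp⟩ := hA
    have hxu : x ≠ u := by rintro rfl; have := hx.2; simp at this; omega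
    obtain ⟨g⟩ := hx.1
    obtain ⟨c, -, hcx, hck⟩ := hG.exists_adj_closer hxu g
    rw [hx.2] at hck
    refine P4FreeOn.exists_isTwinOrPendant
      (S := {z | z ∈ L ∧ ∀ p, G.dist u p + 1 = k → (G.Adj p z ↔ G.Adj p x)})
      ⟨x, ⟨hx, fun _ _ => Iff.rfl⟩, y, ⟨hy, fun p hp => (hxyp p hp).symm⟩, hxy⟩
      (hG.p4FreeOn_of_common_neighbor (c := c) fun s hs => (hs.2 c hck).2 hcx) ?_
    rintro a ⟨ha, hax⟩ b ⟨hb, hbx⟩ z hz haz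
    obtain ⟨hzr, hzk | hzk⟩ := hnbr a ha z haz
    · refine absurd ⟨⟨hzr, hzk⟩, fun p hp => ?_⟩ hz
      rw [← hax p hp]
      exact ⟨hsame z ⟨hzr, hzk⟩ a ha haz.symm p hp, hsame a ha z ⟨hzr, hzk⟩ haz p hp⟩
    · exact ((hbx z hzk).2 ((hax z hzk).1 haz.symm)).symm
  push Not at hA
  have hind : ∀ a ∈ L, ∀ b ∈ L, ¬ G.Adj a b := by
    intro a ha b hb hab
    obtain ⟨p, hp, h⟩ := hA a ha b hb hab.ne
    have h1 := hsame a ha b hb hab p hp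
    have h2 := hsame b hb a ha hab.symm p hp
    grind
  obtain ⟨v, hv, hmin⟩ := Set.exists_min_image L (fun z => (G.neighborSet z).ncard)
    (Set.toFinite _) ⟨v₀, hv₀, hk.symm⟩
  have hSd : ∀ s, G.Adj v s → G.Reachable u s ∧ G.dist u s + 1 = k := by
    intro s hs
    obtain ⟨h1, h2 | h2⟩ := hnbr v hv s hs
    · exact absurd hs (hind v hv s ⟨h1, h2⟩)
    · exact ⟨h1, h2⟩
  have hvu : v ≠ u := by rintro rfl; have := hv.2; simp at this; omega
  obtain ⟨g⟩ := hv.1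
  obtain ⟨s, -, hsv, -⟩ := hG.exists_adj_closer hvu g
  by_cases hS : (G.neighborSet v).Nontrivial
  swap
  · rw [Set.not_nontrivial_iff] at hS
    exact ⟨s, v, hsv.ne, Or.inr fun z hz hvz => hz (hS hvz hsv.symm)⟩
  -- For `k = 1` every neighbour of `v` would be `u`.
  have hk2 : 2 ≤ k := by
    by_contra hlt
    obtain ⟨a, ha, b, hb, hab⟩ := hS
    have h1 := hSd a ha
    have h2 := hSd b hb
    have e1 : u = a := h1.1.dist_eq_zero_iff.1 (by omega)
    have e2 : u = b := h2.1.dist_eq_zero_iff.1 (by omega)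
    exact hab (e1.symm.trans e2)
  refine P4FreeOn.exists_isTwinOrPendant hS
    (hG.p4FreeOn_of_common_neighbor (c := v) fun s hs => hs) ?_
  intro a ha b hb z hz haz
  by_contra hbz
  rw [mem_neighborSet] at ha hb hz
  obtain ⟨hra, hda⟩ := hSd a ha
  obtain ⟨hrb, hdb⟩ := hSd b hb
  have hvd := hv.2
  have below : ∀ p, G.Adj p a → G.dist u p + 2 = k → G.Adj p b := by
    intro p hp hpk
    refine hG.adj_of_walk_above (hra.trans hp.symm.reachable) hp (by omega) (by omega)
      (.cons ha.symm (.cons hb .nil)) ?_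
    simp
    omega
  have hau : a ≠ u := by rintro rfl; simp at hda; omega
  obtain ⟨g, -⟩ := hra.exists_geodesic
  obtain ⟨c, -, hca, hcd⟩ := hG.exists_adj_closer hau g
  have hcb := below c hca (by omega)
  have hcL : ∀ e ∈ L, ¬ G.Adj c e := by
    intro e he hce
    have := (hnbr e he c hce.symm).2
    omega
  have hrz := hra.trans haz.reachable
  have hrc := hra.trans hca.symm.reachable
  have hzk := hmax z hrz
  have hdz := haz.diff_dist_adj (u := u)
  have : G.dist u z = k ∨ G.dist u z + 1 = k ∨ G.dist u z + 2 = k := by omega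
  rcases this with h | h | h
  · have hzL : z ∈ L := ⟨hrz, h⟩
    -- Otherwise the neighbourhood of `z` lies in that of `v` and misses `b`, against the minimality
    -- of `v`.
    have : ∃ e, G.Adj z e ∧ ¬ G.Adj v e := by
      by_contra! hcon
      have hlt : (G.neighborSet z).ncard < (G.neighborSet v).ncard :=
        Set.ncard_lt_ncard ⟨hcon, fun hsub => hbz (hsub hb : G.Adj z b).symm⟩
      exact absurd (hmin z hzL) (by simpa using hlt)
    obtain ⟨e, hze, hve⟩ := this
    have hde : G.dist u e + 1 = k := by
      obtain ⟨h1, h2 | h2⟩ := hnbr z hzL e hze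
      · exact absurd hze (hind z hzL e ⟨h1, h2⟩)
      · exact h2
    have hce : G.Adj c e := by
      refine hG.adj_of_walk_above hrc hca hcd (by omega) (.cons haz (.cons hze .nil)) ?_
      simp
      omega
    exact hG.not_crossing (hind v hv z hzL) ha haz.symm hb (fun h => hbz h.symm) hze hve hcb hce
      (hcL v hv)
  · have hcz : G.Adj c z := by
      refine hG.adj_of_walk_above hrc hca hcd (by omega) (.cons haz .nil) ?_
      simp
      omega
    by_cases hab : G.Adj a b
    · have hzv : z ≠ v := by rintro rfl; omega
      obtain ⟨m, hm, h1, h2⟩ := hG.exists_common_neighbor_mem hzv (fun h => hz h.symm) haz.symm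
        ha.symm (.cons hcz.symm (.cons hcb (.cons hb.symm .nil)))
      simp only [Walk.support_cons, Walk.support_nil, List.mem_cons, List.not_mem_nil,
        or_false] at hm
      rcases hm with rfl | rfl | rfl | rfl
      · exact h1.ne rfl
      · exact hcL v hv h2
      · exact hbz h1.symm
      · exact h2.ne rfl
    · have hzb : z ≠ b := by rintro rfl; exact hz hb
      obtain ⟨m, hm, h1, h2⟩ := hG.exists_common_neighbor_mem hzb (fun h => hbz h.symm) hcz.symm
        hcb (.cons haz.symm (.cons ha.symm (.cons hb .nil)))
      simp only [Walk.support_cons, Walk.support_nil, List.mem_cons, List.not_mem_nil,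
        or_false] at hm
      rcases hm with rfl | rfl | rfl | rfl
      · exact h1.ne rfl
      · exact hab h2
      · exact hz h1.symm
      · exact h2.ne rfl
  · exact hbz (below z haz.symm h).symm

end Levels

end SimpleGraph

/-! ### Least common ancestors when a vertex is attached to a digraph -/

namespace Digraph

variable {V W : Type*} {N : Digraph V} {M : Digraph W} {f : V → W} {l : W} {p : V}

theorem toSimpleGraphInclusive_adj {a b : V} :
    N.toSimpleGraphInclusive.Adj a b ↔ a ≠ b ∧ (N.Adj a b ∨ N.Adj b a) :=
  Iff.rfl

theorem IsAcyclic.not_isAncestor (hN : N.IsAcyclic) {a b : V} (h : N.Adj a b) :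
    ¬ N.IsAncestor b a :=
  fun h' => hN a (Relation.TransGen.head' h h')

theorem IsAcyclic.ne (hN : N.IsAcyclic) {a b : V} (h : N.Adj a b) : a ≠ b := by
  rintro rfl
  exact hN.not_isAncestor h .refl

theorem IsAncestor.eq_or_exists_adj {a b : V} (h : N.IsAncestor a b) :
    a = b ∨ ∃ c, N.Adj a c ∧ N.IsAncestor c b := by
  rcases h.cases_head with h | h
  · exact Or.inl h
  · exact Or.inr h

theorem IsAncestor.eq_or_exists_adj_right {a b : V} (h : N.IsAncestor a b) :
    a = b ∨ ∃ c, N.IsAncestor a c ∧ N.Adj c b := by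
  rcases h.cases_tail with h | h
  · exact Or.inl h.symm
  · exact Or.inr h

theorem isLCA_congr {x y x' y' : V}
    (h : ∀ w, N.IsAncestor w x ∧ N.IsAncestor w y ↔ N.IsAncestor w x' ∧ N.IsAncestor w y') (u : V) :
    N.IsLCA u x y ↔ N.IsLCA u x' y' := by
  simp only [IsLCA, h]

theorem isUniqueLCA_congr {x y x' y' : V}
    (h : ∀ u, N.IsLCA u x y ↔ N.IsLCA u x' y') (u : V) :
    N.IsUniqueLCA u x y ↔ N.IsUniqueLCA u x' y' := by
  simp only [IsUniqueLCA, h]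

theorem isUniqueLCA_of_forall_iff {x y v : V} {P : Prop}
    (h : ∀ u, N.IsLCA u x y ↔ u = v ∧ P) (u : V) : N.IsUniqueLCA u x y ↔ u = v ∧ P := by
  simp only [IsUniqueLCA, h]
  exact ⟨fun h => h.1, fun h' => ⟨h', fun w hw => hw.1.trans h'.1.symm⟩⟩

/-- The graph on all vertices of `N` in which two distinct vertices are adjacent if they have a
unique least common ancestor and it satisfies `T`. -/
def lcaGraph (N : Digraph V) (T : V → Prop) : SimpleGraph V where
  Adj x y := x ≠ y ∧ ∃ u, N.IsUniqueLCA u x y ∧ T u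
  symm := ⟨fun _ _ h => ⟨h.1.symm, h.2.imp fun _ hu => ⟨hu.1.symm, hu.2⟩⟩⟩
  loopless := ⟨fun _ h => h.1 rfl⟩

theorem lcaGraph_adj {T : V → Prop} {x y : V} :
    (N.lcaGraph T).Adj x y ↔ x ≠ y ∧ ∃ u, N.IsUniqueLCA u x y ∧ T u :=
  Iff.rfl

theorem lcaGraph_adj_congr {T T' : V → Prop} {x y : V} (h : ∀ u, N.IsLCA u x y → (T u ↔ T' u)) :
    (N.lcaGraph T).Adj x y ↔ (N.lcaGraph T').Adj x y := by
  simp only [lcaGraph_adj]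
  exact and_congr_right fun _ => exists_congr fun u => and_congr_right fun hu => h u hu.1

/-- `M` arises from `N` by attaching the new vertex `l` to `p`, where `f` is the inclusion. -/
structure IsLeafExtension (N : Digraph V) (M : Digraph W) (f : V → W) (l : W) (p : V) : Prop where
  injective : Function.Injective f
  ne : ∀ v, f v ≠ l
  exists_eq : ∀ w, w ≠ l → ∃ v, f v = w
  adj_iff : ∀ a b, M.Adj (f a) (f b) ↔ N.Adj a b
  eq_of_adj_left : ∀ w, M.Adj l w → w = f p
  eq_of_adj_right : ∀ w, M.Adj w l → w = f p
  adj : M.Adj l (f p) ∨ M.Adj (f p) l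
  sink_or_source : (∀ w, ¬ M.Adj l w) ∨ ∀ w, ¬ M.Adj w l

namespace IsLeafExtension

theorem isAncestor_iff (h : IsLeafExtension N M f l p) {a b : V} :
    M.IsAncestor (f a) (f b) ↔ N.IsAncestor a b := by
  refine ⟨fun hab => ?_, fun hab => hab.lift f fun a b => (h.adj_iff a b).2⟩
  rcases h.sink_or_source with hs | hs
  · have key : ∀ w, M.IsAncestor w (f b) → ∃ a, f a = w ∧ N.IsAncestor a b := by
      intro w hw
      induction hw using Relation.ReflTransGen.head_induction_on with
      | refl => exact ⟨b, rfl, .refl⟩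
      | @head w w' hww' _ ih =>
        obtain ⟨a', rfl, ha'⟩ := ih
        obtain ⟨a, rfl⟩ := h.exists_eq w (by rintro rfl; exact hs _ hww')
        exact ⟨a, rfl, .head ((h.adj_iff _ _).1 hww') ha'⟩
    obtain ⟨a', ha', hab'⟩ := key _ hab
    rwa [← h.injective ha']
  · have key : ∀ w, M.IsAncestor (f a) w → ∃ b, f b = w ∧ N.IsAncestor a b := by
      intro w hw
      induction hw with
      | refl => exact ⟨a, rfl, .refl⟩
      | @tail w w' _ hww' ih =>
        obtain ⟨a', rfl, ha'⟩ := ih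
        obtain ⟨b, rfl⟩ := h.exists_eq w' (by rintro rfl; exact hs _ hww')
        exact ⟨b, rfl, .tail ha' ((h.adj_iff _ _).1 hww')⟩
    obtain ⟨b', hb', hab'⟩ := key _ hab
    rwa [← h.injective hb']

theorem isAcyclic_iff (h : IsLeafExtension N M f l p) : M.IsAcyclic ↔ N.IsAcyclic := by
  refine ⟨fun hM v hv => hM (f v) (hv.lift f fun a b => (h.adj_iff a b).2), fun hN v hv => ?_⟩
  obtain ⟨w, hvw, hwv⟩ := Relation.TransGen.head'_iff.1 hv
  obtain ⟨w', -, hwv'⟩ := Relation.TransGen.tail'_iff.1 hv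
  have hvl : v ≠ l := by
    rintro rfl
    rcases h.sink_or_source with hs | hs
    · exact hs _ hvw
    · exact hs _ hwv'
  obtain ⟨a, rfl⟩ := h.exists_eq v hvl
  by_cases hwl : w = l
  · subst hwl
    rcases h.sink_or_source with hs | hs
    · rcases IsAncestor.eq_or_exists_adj hwv with e | ⟨c, hc, -⟩
      · exact hvl e.symm
      · exact hs _ hc
    · exact hs _ hvw
  · obtain ⟨b, rfl⟩ := h.exists_eq w hwl
    exact hN.not_isAncestor ((h.adj_iff a b).1 hvw) (h.isAncestor_iff.1 hwv)

theorem isLCA_iff (h : IsLeafExtension N M f l p) {u x y : V} :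
    M.IsLCA (f u) (f x) (f y) ↔ N.IsLCA u x y := by
  simp only [IsLCA, h.isAncestor_iff]
  refine and_congr_right fun _ => ⟨fun H c hc hcxy => ?_, fun H c hc hcxy => ?_⟩
  · exact H (f c) ((h.adj_iff _ _).2 hc) (by simpa only [h.isAncestor_iff] using hcxy)
  · by_cases hcl : c = l
    · subst hcl
      rcases h.sink_or_source with hs | hs
      · rcases IsAncestor.eq_or_exists_adj hcxy.1 with e | ⟨c, hc, -⟩
        · exact h.ne _ e.symm
        · exact hs _ hc
      · exact hs _ hc
    · obtain ⟨c, rfl⟩ := h.exists_eq c hcl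
      exact H c ((h.adj_iff _ _).1 hc) (by simpa only [h.isAncestor_iff] using hcxy)

/-- Any descendant of `l` other than `l` is reached through the single child `f p`, so that child is
a common ancestor too. -/
theorem not_isLCA (h : IsLeafExtension N M f l p) {x y : V} : ¬ M.IsLCA l (f x) (f y) := by
  rintro ⟨⟨hx, hy⟩, hc⟩
  have key : ∀ x, M.IsAncestor l (f x) → M.Adj l (f p) ∧ M.IsAncestor (f p) (f x) := by
    intro x hx
    rcases IsAncestor.eq_or_exists_adj hx with e | ⟨c, hc, hcx⟩
    · exact absurd e.symm (h.ne x)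
    · obtain rfl := h.eq_of_adj_left c hc
      exact ⟨hc, hcx⟩
  exact hc _ (key x hx).1 ⟨(key x hx).2, (key y hy).2⟩

theorem isUniqueLCA_iff (h : IsLeafExtension N M f l p) {u x y : V} :
    M.IsUniqueLCA (f u) (f x) (f y) ↔ N.IsUniqueLCA u x y := by
  simp only [IsUniqueLCA, h.isLCA_iff]
  refine and_congr_right fun _ => ⟨fun H w hw => ?_, fun H w hw => ?_⟩
  · exact h.injective (H (f w) (h.isLCA_iff.2 hw))
  · obtain ⟨w, rfl⟩ := h.exists_eq w (by rintro rfl; exact h.not_isLCA hw)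
    rw [H w (h.isLCA_iff.1 hw)]

theorem lcaGraph_adj_iff (h : IsLeafExtension N M f l p) {T : W → Prop} {x y : V} :
    (M.lcaGraph T).Adj (f x) (f y) ↔ (N.lcaGraph (T ∘ f)).Adj x y := by
  rw [lcaGraph_adj, lcaGraph_adj, h.injective.ne_iff]
  refine and_congr_right fun _ => ⟨?_, ?_⟩
  · rintro ⟨u, hu, hT⟩
    obtain ⟨u, rfl⟩ := h.exists_eq u (by rintro rfl; exact h.not_isLCA hu.1)
    exact ⟨u, h.isUniqueLCA_iff.1 hu, hT⟩
  · rintro ⟨u, hu, hT⟩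
    exact ⟨f u, h.isUniqueLCA_iff.2 hu, hT⟩

theorem toSimpleGraphInclusive_adj_iff (h : IsLeafExtension N M f l p) {a b : V} :
    M.toSimpleGraphInclusive.Adj (f a) (f b) ↔ N.toSimpleGraphInclusive.Adj a b := by
  simp only [toSimpleGraphInclusive_adj, h.adj_iff, h.injective.ne_iff]

theorem eq_of_toSimpleGraphInclusive_adj (h : IsLeafExtension N M f l p) {w : W}
    (hw : M.toSimpleGraphInclusive.Adj l w) : w = f p :=
  hw.2.elim (h.eq_of_adj_left w) (h.eq_of_adj_right w)

theorem connected_iff (h : IsLeafExtension N M f l p) :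
    M.toSimpleGraphInclusive.Connected ↔ N.toSimpleGraphInclusive.Connected := by
  classical
  constructor
  · intro hM
    have : Nonempty V := ⟨p⟩
    choose g hg using h.exists_eq
    set k : W → V := fun w => if hw : w = l then p else g w hw with hk
    have kl : k l = p := by simp [hk]
    have kf : ∀ v, k (f v) = v := fun v => by
      have : ¬ f v = l := h.ne v
      simp only [hk, dif_neg this]
      exact h.injective (hg _ _)
    refine ⟨fun a b => ?_⟩
    obtain ⟨w⟩ := hM.preconnected (f a) (f b)
    obtain ⟨q, -⟩ := w.exists_weakMap (H := N.toSimpleGraphInclusive) k fun c d hcd => by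
      by_cases hc : c = l
      · subst hc
        rw [h.eq_of_toSimpleGraphInclusive_adj hcd, kl, kf]
        exact Or.inl rfl
      by_cases hd : d = l
      · subst hd
        rw [h.eq_of_toSimpleGraphInclusive_adj hcd.symm, kl, kf]
        exact Or.inl rfl
      obtain ⟨c, rfl⟩ := h.exists_eq c hc
      obtain ⟨d, rfl⟩ := h.exists_eq d hd
      rw [kf, kf]
      exact Or.inr (h.toSimpleGraphInclusive_adj_iff.1 hcd)
    rw [kf, kf] at q
    exact ⟨q⟩
  · intro hN
    have : Nonempty W := ⟨l⟩
    have key : ∀ w, M.toSimpleGraphInclusive.Reachable (f p) w := by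
      intro w
      by_cases hw : w = l
      · subst hw
        exact SimpleGraph.Adj.reachable ⟨h.ne p, h.adj.symm⟩
      · obtain ⟨v, rfl⟩ := h.exists_eq w hw
        exact (hN.preconnected p v).map
          ⟨f, fun hab => h.toSimpleGraphInclusive_adj_iff.2 hab⟩
    exact ⟨fun a b => (key a).symm.trans (key b)⟩

theorem isTree_iff (h : IsLeafExtension N M f l p) :
    M.toSimpleGraphInclusive.IsTree ↔ N.toSimpleGraphInclusive.IsTree := by
  constructor
  · intro hM
    refine ⟨h.connected_iff.1 hM.connected, ?_⟩
    exact hM.isAcyclic.comap ⟨f, fun hab => h.toSimpleGraphInclusive_adj_iff.2 hab⟩ h.injective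
  · intro hN
    refine ⟨h.connected_iff.2 hN.connected, ?_⟩
    classical
    intro v c hc
    -- A cycle through `l` would enter and leave it through the same neighbour `f p`.
    have hl : l ∉ c.support := by
      intro hl
      have hr := hc.rotate hl
      apply hr.snd_ne_penultimate
      rw [h.eq_of_toSimpleGraphInclusive_adj ((c.rotate l hl).adj_snd hr.not_nil),
        h.eq_of_toSimpleGraphInclusive_adj ((c.rotate l hl).adj_penultimate hr.not_nil).symm]
    choose g hg using fun w : ({l}ᶜ : Set W) => h.exists_eq w w.2
    have hind : (M.toSimpleGraphInclusive.induce {l}ᶜ).IsAcyclic := by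
      refine hN.isAcyclic.comap ⟨g, fun {a b} hab => ?_⟩ fun a b hab => ?_
      · rw [← h.toSimpleGraphInclusive_adj_iff, hg, hg]
        exact hab
      · have := congrArg f hab
        exact Subtype.ext (by rwa [RelHom.coeFn_mk, hg, hg] at this)
    have hs : ∀ z ∈ c.support, z ∈ ({l}ᶜ : Set W) := fun z hz => by
      rintro rfl; exact hl hz
    refine hind (c.induce _ hs) ?_
    rw [← SimpleGraph.Walk.isCycle_map_iff_of_injective (f := (SimpleGraph.Embedding.induce _).toHom)
      Subtype.val_injective, SimpleGraph.Walk.map_induce]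
    exact hc

section Child

theorem isAncestor_left_of_sink (hl : ∀ w, ¬ M.Adj l w) {w : W} : M.IsAncestor l w ↔ l = w := by
  refine ⟨fun h => ?_, fun h => h ▸ .refl⟩
  rcases h.eq_or_exists_adj with h | ⟨c, hc, -⟩
  · exact h
  · exact absurd hc (hl c)

theorem isAncestor_right_of_source (hl : ∀ w, ¬ M.Adj w l) {w : W} :
    M.IsAncestor w l ↔ w = l := by
  refine ⟨fun h => ?_, fun h => h ▸ .refl⟩
  rcases h.eq_or_exists_adj_right with h | ⟨c, -, hc⟩
  · exact h
  · exact absurd hc (hl c)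

/-- A proper ancestor of `l` is an ancestor of its only parent. Hence a new sink is a twin of its
parent in `lcaGraph`. -/
theorem isLCA_of_sink (h : IsLeafExtension N M f l p) (hl : ∀ w, ¬ M.Adj l w) {u z : W}
    (hz : z ≠ l) : M.IsLCA u l z ↔ M.IsLCA u (f p) z := by
  refine isLCA_congr (fun w => and_congr_left fun hwz => ⟨fun hwl => ?_, fun hw => ?_⟩) u
  · rcases hwl.eq_or_exists_adj_right with rfl | ⟨c, hwc, hc⟩
    · exact absurd ((isAncestor_left_of_sink hl).1 hwz).symm hz
    · rwa [← h.eq_of_adj_right c hc]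
  · exact hw.tail (h.adj.resolve_left (hl _))

theorem lcaGraph_adj_of_sink (h : IsLeafExtension N M f l p) (hl : ∀ w, ¬ M.Adj l w)
    {T : W → Prop} {z : W} (hz : z ≠ l) (hzp : z ≠ f p) :
    (M.lcaGraph T).Adj l z ↔ (M.lcaGraph T).Adj (f p) z := by
  simp only [lcaGraph_adj, isUniqueLCA_congr (fun u => h.isLCA_of_sink hl hz), ne_eq, hz.symm,
    hzp.symm, not_false_eq_true]

theorem lcaGraph_adj_parent_of_sink (h : IsLeafExtension N M f l p) (hM : M.IsAcyclic)
    (hl : ∀ w, ¬ M.Adj l w) {T : W → Prop} : (M.lcaGraph T).Adj l (f p) ↔ T (f p) := by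
  have key : ∀ u, M.IsUniqueLCA u l (f p) ↔ u = f p ∧ True := by
    refine isUniqueLCA_of_forall_iff fun u => ?_
    rw [h.isLCA_of_sink hl (h.ne p)]
    constructor
    · rintro ⟨⟨hu, -⟩, hc⟩
      rcases hu.eq_or_exists_adj with e | ⟨c, huc, hcp⟩
      · exact ⟨e, trivial⟩
      · exact absurd ⟨hcp, hcp⟩ (hc c huc)
    · rintro ⟨rfl, -⟩
      exact ⟨⟨.refl, .refl⟩, fun c hc hcp => hM.not_isAncestor hc hcp.1⟩
  simp [lcaGraph_adj, key, (h.ne p).symm]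

end Child

section Parent

theorem isAncestor_left_of_source (h : IsLeafExtension N M f l p) {w : W} (hw : w ≠ l)
    (hl : ∀ w, ¬ M.Adj w l) : M.IsAncestor l w ↔ M.IsAncestor (f p) w := by
  constructor
  · intro hlw
    rcases hlw.eq_or_exists_adj with e | ⟨c, hc, hcw⟩
    · exact absurd e.symm hw
    · rwa [← h.eq_of_adj_left c hc]
  · exact fun hpw => hpw.head (h.adj.resolve_right (hl _))

theorem isLCA_of_source (h : IsLeafExtension N M f l p) (hl : ∀ w, ¬ M.Adj w l) {u z : W}
    (hz : z ≠ l) : M.IsLCA u l z ↔ u = l ∧ M.IsAncestor (f p) z := by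
  rw [← h.isAncestor_left_of_source hz hl]
  constructor
  · rintro ⟨⟨hu, huz⟩, -⟩
    obtain rfl := (isAncestor_right_of_source hl).1 hu
    exact ⟨rfl, huz⟩
  · rintro ⟨rfl, hz⟩
    refine ⟨⟨.refl, hz⟩, fun c hc hcu => ?_⟩
    obtain rfl := (isAncestor_right_of_source hl).1 hcu.1
    exact hl _ hc

theorem lcaGraph_adj_of_source (h : IsLeafExtension N M f l p) (hl : ∀ w, ¬ M.Adj w l)
    {T : W → Prop} {z : W} :
    (M.lcaGraph T).Adj l z ↔ T l ∧ M.IsAncestor (f p) z := by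
  by_cases hz : z = l
  · subst hz
    refine iff_of_false (fun h => h.ne rfl) fun h' => ?_
    exact h.ne p ((isAncestor_right_of_source hl).1 h'.2)
  · simp only [lcaGraph_adj, isUniqueLCA_of_forall_iff fun u => h.isLCA_of_source hl hz]
    grind

/-- The only other candidate for a least common ancestor is `l`, and it is excluded by its child `f
p`. -/
theorem lcaGraph_adj_child_of_source (h : IsLeafExtension N M f l p) (hM : M.IsAcyclic)
    (hl : ∀ w, ¬ M.Adj w l) (hp : ∀ w, M.Adj w (f p) → w = l) {T : W → Prop} {z : W} (hz : z ≠ l)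
    (hzp : z ≠ f p) : (M.lcaGraph T).Adj (f p) z ↔ T (f p) ∧ M.IsAncestor (f p) z := by
  have key : ∀ u, M.IsLCA u (f p) z ↔ u = f p ∧ M.IsAncestor (f p) z := by
    intro u
    constructor
    · rintro ⟨⟨hu, huz⟩, hc⟩
      rcases hu.eq_or_exists_adj_right with rfl | ⟨c, huc, hcp⟩
      · exact ⟨rfl, huz⟩
      · obtain rfl := hp c hcp
        obtain rfl := (isAncestor_right_of_source hl).1 huc
        exact absurd ⟨.refl, (h.isAncestor_left_of_source hz hl).1 huz⟩ (hc _ hcp)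
    · rintro ⟨rfl, hz⟩
      exact ⟨⟨.refl, hz⟩, fun c hc hcp => hM.not_isAncestor hc hcp.1⟩
  simp only [lcaGraph_adj, isUniqueLCA_of_forall_iff key]
  grind

end Parent

end IsLeafExtension

end Digraph

/-! ### Finite trees near a farthest vertex -/

namespace SimpleGraph

variable {V : Type*} {G : SimpleGraph V}

theorem IsTree.eq_of_adj_of_dist_add_one (hG : G.IsTree) {r a b w : V} (ha : G.Adj a w)
    (hb : G.Adj b w) (hda : G.dist r a + 1 = G.dist r w) (hdb : G.dist r b + 1 = G.dist r w) :
    a = b := by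
  obtain ⟨p, hp⟩ := hG.connected.exists_walk_length_eq_dist r a
  obtain ⟨q, hq⟩ := hG.connected.exists_walk_length_eq_dist r b
  have h1 : (p.concat ha).IsPath := (p.concat ha).isPath_of_length_eq_dist (by simp; omega)
  have h2 : (q.concat hb).IsPath := (q.concat hb).isPath_of_length_eq_dist (by simp; omega)
  have h3 := (hG.existsUnique_path r w).unique h1 h2
  have h4 := congrArg Walk.penultimate h3
  simpa using h4

/-- A finite tree has a vertex all of whose neighbours, except possibly one, are leaves. -/
theorem IsTree.exists_all_but_one_leaves [Finite V] [Nontrivial V] (hG : G.IsTree) :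
    ∃ p q l, G.Adj p l ∧ l ≠ q ∧ ∀ w, G.Adj p w → w ≠ q → ∀ z, G.Adj w z → z = p := by
  obtain ⟨r⟩ := hG.connected.nonempty
  obtain ⟨l, hl⟩ := Finite.exists_max (G.dist r)
  have hlr : l ≠ r := by
    rintro rfl
    obtain ⟨x, hx⟩ := exists_ne l
    have h1 := hl x
    have h2 := hG.connected.pos_dist_of_ne hx.symm
    rw [dist_self] at h1
    omega
  have hpred : ∀ v, v ≠ r → ∃ p, G.Adj p v ∧ G.dist r p + 1 = G.dist r v := by
    intro v hv
    obtain ⟨q, hq⟩ := hG.connected.exists_walk_length_eq_dist r v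
    have hnil : ¬ q.Nil := fun h => hv h.eq.symm
    have hadj := q.adj_penultimate hnil
    refine ⟨q.penultimate, hadj, ?_⟩
    have h1 := dist_le q.dropLast
    have h2 : q.dropLast.length + 1 = q.length := by
      have := congrArg Walk.length (q.concat_dropLast hadj)
      rwa [Walk.length_concat] at this
    have h3 := hadj.diff_dist_adj (u := r)
    omega
  obtain ⟨p, hpl, hdp⟩ := hpred l hlr
  have main : ∀ w, G.Adj p w → G.dist r w = G.dist r p + 1 → ∀ z, G.Adj w z → z = p := by
    intro w hpw hdw z hwz
    have h1 := hl z
    rcases hG.dist_eq_dist_add_one_of_adj r hwz with h2 | h2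
    · exact hG.eq_of_adj_of_dist_add_one hwz.symm hpw h2.symm hdw.symm
    · omega
  by_cases hpr : p = r
  -- Here `p` is the root and no neighbour has to be excepted; `q = p` is a dummy value.
  · refine ⟨p, p, l, hpl, hpl.ne', fun w hpw _ => main w hpw ?_⟩
    subst hpr
    rw [dist_self, dist_eq_one_iff_adj.2 hpw]
  · obtain ⟨q, hqp, hdq⟩ := hpred p hpr
    refine ⟨p, q, l, hpl, by rintro rfl; omega, fun w hpw hwq => main w hpw ?_⟩
    rcases hG.dist_eq_dist_add_one_of_adj r hpw with h2 | h2
    · exact absurd (hG.eq_of_adj_of_dist_add_one hpw.symm hqp h2.symm hdq) hwq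
    · exact h2

end SimpleGraph

/-! ### The graph of a labelled oriented tree is walk-hereditary -/

namespace Digraph

variable {W : Type*} {M : Digraph W}

theorem IsAcyclic.isLeafExtension (hM : M.IsAcyclic) {l p : W}
    (hpl : M.toSimpleGraphInclusive.Adj p l)
    (hl : ∀ z, M.toSimpleGraphInclusive.Adj l z → z = p) :
    IsLeafExtension ⟨fun a b : ({l}ᶜ : Set W) => M.Adj a b⟩ M Subtype.val l ⟨p, hpl.1⟩ where
  injective := Subtype.val_injective
  ne v := v.2
  exists_eq w hw := ⟨⟨w, hw⟩, rfl⟩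
  adj_iff _ _ := Iff.rfl
  eq_of_adj_left w hw := hl w ⟨hM.ne hw, Or.inl hw⟩
  eq_of_adj_right w hw := hl w ⟨(hM.ne hw).symm, Or.inr hw⟩
  adj := hpl.2.symm
  sink_or_source := by
    rcases hpl.2 with h | h
    · left
      intro w hw
      obtain rfl := hl w ⟨hM.ne hw, Or.inl hw⟩
      exact hM.not_isAncestor h (.single hw)
    · right
      intro w hw
      obtain rfl := hl w ⟨(hM.ne hw).symm, Or.inr hw⟩
      exact hM.not_isAncestor h (.single hw)

/-- A tree leaf below `p` is a twin of `p`. If all tree leaves at `p` other than `q` are sources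
above `p`, then one with false label is isolated, two with true labels are twins, and one is at most
pendant if `p` has no child. What remains is a path `l → p → q` with `l` the only parent and `q` the
only child of `p`. -/
theorem isWalkHereditary_lcaGraph {W : Type*} [Finite W] {M : Digraph W} (hM : M.IsAcyclic)
    (hT : M.toSimpleGraphInclusive.IsTree) (T : W → Prop) : (M.lcaGraph T).IsWalkHereditary := by
  classical
  induction hk : Nat.card W using Nat.strong_induction_on generalizing W with
  | _ k ih =>
  rcases subsingleton_or_nontrivial W with hW | hW
  · intro a b p q
    obtain rfl := Subsingleton.elim a b
    exact ⟨.nil, by simp, by simp⟩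
  obtain ⟨p, q, l, hpl, hlq, hall⟩ := hT.exists_all_but_one_leaves
  have hext := fun w (hw : M.toSimpleGraphInclusive.Adj p w) (hwq : w ≠ q) =>
    hM.isLeafExtension hw (hall w hw hwq)
  have reduce : ∀ (T : W → Prop) (w x : W), M.toSimpleGraphInclusive.Adj p w → w ≠ q → x ≠ w →
      (M.lcaGraph T).IsTwinOrPendant x w → (M.lcaGraph T).IsWalkHereditary := by
    intro T w x hpw hwq hxw hx
    refine SimpleGraph.IsWalkHereditary.of_isTwinOrPendant hxw hx ?_
    have h := hext w hpw hwq
    have hcard : Nat.card ({w}ᶜ : Set W) < k := by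
      rw [← hk, Nat.card_coe_set_eq]
      exact Set.ncard_lt_card (by simp)
    have := ih _ hcard (h.isAcyclic_iff.1 hM) (h.isTree_iff.1 hT) (T ∘ Subtype.val) rfl
    convert this using 1
    ext a b
    exact h.lcaGraph_adj_iff
  by_cases h1 : ∃ w, w ≠ q ∧ M.Adj p w
  · obtain ⟨w, hwq, hpw⟩ := h1
    have hadj : M.toSimpleGraphInclusive.Adj p w := ⟨hM.ne hpw, Or.inl hpw⟩
    have h := hext w hadj hwq
    have hsink : ∀ z, ¬ M.Adj w z := h.sink_or_source.resolve_right fun h => h p hpw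
    exact reduce T w p hadj hwq hadj.ne
      (Or.inl fun z hzp hzw => h.lcaGraph_adj_of_sink hsink hzw hzp)
  push Not at h1
  replace h1 : ∀ w, M.Adj p w → w = q := fun w hw => by
    by_contra hne; exact h1 w hne hw
  have hsource : ∀ w, M.toSimpleGraphInclusive.Adj p w → w ≠ q →
      M.Adj w p ∧ ∀ z, ¬ M.Adj z w := by
    intro w hpw hwq
    have hwp : M.Adj w p := hpw.2.resolve_left fun h => hwq (h1 w h)
    exact ⟨hwp, (hext w hpw hwq).sink_or_source.resolve_left fun h => h p hwp⟩
  have hadj : ∀ T w, M.toSimpleGraphInclusive.Adj p w → w ≠ q → ∀ z,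
      (M.lcaGraph T).Adj w z ↔ T w ∧ M.IsAncestor p z :=
    fun T w hpw hwq z => (hext w hpw hwq).lcaGraph_adj_of_source (hsource w hpw hwq).2
  have isolated : ∀ w, M.toSimpleGraphInclusive.Adj p w → w ≠ q → ¬ T w →
      (M.lcaGraph T).IsWalkHereditary := fun w hpw hwq hTw =>
    reduce T w p hpw hwq hpw.ne (Or.inr fun z _ h => hTw ((hadj T w hpw hwq z).1 h).1)
  by_cases hTl : T l
  swap
  · exact isolated l hpl hlq hTl
  by_cases hpq : M.Adj p q
  swap
  · refine reduce T l p hpl hlq hpl.ne (Or.inr fun z hz h => ?_)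
    rcases ((hadj T l hpl hlq z).1 h).2.eq_or_exists_adj with e | ⟨c, hc, -⟩
    · exact hz e.symm
    · obtain rfl := h1 c hc
      exact hpq hc
  by_cases h2 : ∃ w, w ≠ l ∧ w ≠ q ∧ M.Adj w p
  · obtain ⟨w, hwl, hwq, hwp⟩ := h2
    have hpw : M.toSimpleGraphInclusive.Adj p w := ⟨(hM.ne hwp).symm, Or.inr hwp⟩
    by_cases hTw : T w
    · refine reduce T l w hpl hlq hwl (Or.inl fun z _ _ => ?_)
      rw [hadj T l hpl hlq, hadj T w hpw hwq]
      simp only [hTl, hTw]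
    · exact isolated w hpw hwq hTw
  push Not at h2
  have hpar : ∀ w, M.Adj w p → w = l := by
    intro w hw
    by_contra hwl
    by_cases hwq : w = q
    · subst hwq; exact hM.not_isAncestor hpq (.single hw)
    · exact h2 w hwl hwq hw
  have hp : ∀ (T : W → Prop) z, z ≠ l → z ≠ p →
      ((M.lcaGraph T).Adj p z ↔ T p ∧ M.IsAncestor p z) := fun T z hzl hzp =>
    (hext l hpl hlq).lcaGraph_adj_child_of_source hM (hsource l hpl hlq).2 hpar hzl hzp
  have twin : ∀ T : W → Prop, T l → T p → (M.lcaGraph T).IsWalkHereditary := by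
    intro T hTl hTp
    refine reduce T l p hpl hlq hpl.ne (Or.inl fun z hzp hzl => ?_)
    rw [hadj T l hpl hlq, hp T z hzl hzp]
    simp only [hTl, hTp]
  by_cases hTp : T p
  · exact twin T hTl hTp
  -- Now `p` is at most pendant at `l`, but deleting it could disconnect the tree. Instead its label
  -- is changed to true, which makes `l` and `p` twins. Having a single child, `p` is never the
  -- least common ancestor of two other vertices, so the graph without `p` is unaffected.
  refine SimpleGraph.IsWalkHereditary.of_isTwinOrPendant hpl.ne' (Or.inr fun z hzl h => ?_) ?_
  · exact hTp ((hp T z hzl h.ne').1 h).1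
  · have h := twin (fun w => w = p ∨ T w) (Or.inr hTl) (Or.inl rfl)
    have e : (M.lcaGraph T).induce {p}ᶜ = (M.lcaGraph fun w => w = p ∨ T w).induce {p}ᶜ := by
      ext ⟨a, ha⟩ ⟨b, hb⟩
      refine lcaGraph_adj_congr (x := a) (y := b) fun u hu => ?_
      have hup : u ≠ p := by
        rintro rfl
        have key : ∀ a, a ≠ u → M.IsAncestor u a → M.IsAncestor q a := by
          intro a ha hua
          rcases hua.eq_or_exists_adj with e | ⟨c, hc, hca⟩
          · exact absurd e.symm ha
          · rwa [← h1 c hc]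
        exact hu.2 q hpq ⟨key a ha hu.1.1, key b hb hu.1.2⟩
      simp [hup]
    rw [e]
    exact h.of_embedding (SimpleGraph.Embedding.induce _)

theorem explainedGraph_adj {t : M.branching → Fin 2} {x y : M.leaves} :
    (M.explainedGraph t).Adj x y ↔ (M.lcaGraph fun u => ∃ h, t ⟨u, h⟩ = 1).Adj x y := by
  rw [lcaGraph_adj, Subtype.coe_injective.ne_iff]
  refine and_congr_right fun _ => ⟨?_, ?_⟩
  · rintro ⟨-, u, hu, ht⟩
    exact ⟨u, hu, u.2, ht⟩
  · rintro ⟨u, hu, hb, ht⟩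
    exact ⟨⟨u, hu.1.1⟩, ⟨u, hb⟩, hu, ht⟩

end Digraph

theorem SimpleGraph.IsArborealExplainable.isWalkHereditary {X : Type u} {G : SimpleGraph X}
    (h : G.IsArborealExplainable) : G.IsWalkHereditary := by
  obtain ⟨V, _, N, t, hN, ⟨e⟩⟩ := h
  refine (Digraph.isWalkHereditary_lcaGraph hN.acyclic hN.isTree
    fun u => ∃ h, t ⟨u, h⟩ = 1).of_embedding ?_
  exact ⟨⟨fun x => (e x : V), fun x y h => e.injective (Subtype.ext h)⟩, by
    intro x y
    rw [← e.map_adj_iff, Digraph.explainedGraph_adj]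
    rfl⟩

/-! ### Building networks by attaching vertices -/

theorem Set.ncard_option {α : Type*} [Finite α] (s : Set (Option α)) [Decidable (none ∈ s)] :
    s.ncard = (some ⁻¹' s).ncard + if none ∈ s then 1 else 0 := by
  have h : s \ {none} = some '' (some ⁻¹' s) := by
    ext (_ | a) <;> simp
  rw [← Set.ncard_image_of_injective _ (Option.some_injective α), ← h]
  split_ifs with hs
  · exact (Set.ncard_sdiff_singleton_add_one hs).symm
  · rw [Set.sdiff_singleton_eq_self hs, add_zero]

namespace Digraph

variable {V : Type*} (N : Digraph V) (v : V)

/-- Attach the new vertex `none` to `v` as a child. -/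
def addChild : Digraph (Option V) where
  Adj
    | some a, some b => N.Adj a b
    | some a, none => a = v
    | none, _ => False

/-- Attach the new vertex `none` to `v` as a parent. -/
def addParent : Digraph (Option V) where
  Adj
    | some a, some b => N.Adj a b
    | none, some b => b = v
    | _, none => False

section

variable {N v}

theorem addChild_not_adj (w : Option V) : ¬ (N.addChild v).Adj none w := id

theorem addParent_not_adj (w : Option V) : ¬ (N.addParent v).Adj w none := by
  cases w <;> exact id

variable (N v)

theorem isLeafExtension_addChild : IsLeafExtension N (N.addChild v) some none v where
  injective := Option.some_injective V
  ne _ := Option.some_ne_none _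
  exists_eq w hw := (Option.ne_none_iff_exists.1 hw)
  adj_iff _ _ := Iff.rfl
  eq_of_adj_left w hw := absurd hw (addChild_not_adj w)
  eq_of_adj_right w hw := by
    cases w with
    | none => exact hw.elim
    | some a => exact congrArg some hw
  adj := Or.inr rfl
  sink_or_source := Or.inl addChild_not_adj

theorem isLeafExtension_addParent : IsLeafExtension N (N.addParent v) some none v where
  injective := Option.some_injective V
  ne _ := Option.some_ne_none _
  exists_eq w hw := (Option.ne_none_iff_exists.1 hw)
  adj_iff _ _ := Iff.rfl
  eq_of_adj_left w hw := by
    cases w with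
    | none => exact hw.elim
    | some a => exact congrArg some hw
  eq_of_adj_right w hw := absurd hw (addParent_not_adj w)
  adj := Or.inl rfl
  sink_or_source := Or.inr addParent_not_adj

end

section Degrees

variable [Finite V]

open Classical in
theorem outdeg_addChild_some (a : V) :
    (N.addChild v).outdeg (some a) = N.outdeg a + if a = v then 1 else 0 := by
  rw [outdeg, Set.ncard_option]
  rfl

theorem outdeg_addChild_none : (N.addChild v).outdeg none = 0 := by
  classical
  rw [outdeg, Set.ncard_option]
  simp [addChild]

theorem indeg_addChild_some (a : V) : (N.addChild v).indeg (some a) = N.indeg a := by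
  classical
  rw [indeg, Set.ncard_option]
  simp [addChild, indeg]

theorem indeg_addChild_none : (N.addChild v).indeg none = 1 := by
  classical
  rw [indeg, Set.ncard_option]
  simp [addChild]

theorem outdeg_addParent_some (a : V) : (N.addParent v).outdeg (some a) = N.outdeg a := by
  classical
  rw [outdeg, Set.ncard_option]
  simp [addParent, outdeg]

theorem outdeg_addParent_none : (N.addParent v).outdeg none = 1 := by
  classical
  rw [outdeg, Set.ncard_option]
  simp [addParent]

open Classical in
theorem indeg_addParent_some (a : V) :
    (N.addParent v).indeg (some a) = N.indeg a + if a = v then 1 else 0 := by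
  rw [indeg, Set.ncard_option]
  rfl

theorem indeg_addParent_none : (N.addParent v).indeg none = 0 := by
  classical
  rw [indeg, Set.ncard_option]
  simp [addParent]

theorem not_adj_of_outdeg_eq_zero {N : Digraph V} {v : V} (h : N.outdeg v = 0) (w : V) :
    ¬ N.Adj v w := fun hw => by
  rw [outdeg, Set.ncard_eq_zero] at h
  exact (h ▸ hw : w ∈ (∅ : Set V))

end Degrees

variable {N}

/-- `N` with the set `T` of branching vertices labelled `1` and the parametrization `φ` of its
leaves explains `G`. -/
structure Explains {X : Type*} (N : Digraph V) (T : V → Prop) (φ : X → V) (G : SimpleGraph X) :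
    Prop where
  injective : Function.Injective φ
  outdeg_eq_zero_iff : ∀ v, N.outdeg v = 0 ↔ ∃ x, φ x = v
  adj_iff : ∀ x y, G.Adj x y ↔ (N.lcaGraph T).Adj (φ x) (φ y)
  two_le_outdeg : ∀ v, T v → 2 ≤ N.outdeg v

theorem Explains.isArborealExplainable {X V : Type u} [Finite V] {N : Digraph V} {T : V → Prop}
    {φ : X → V} {G : SimpleGraph X} (h : N.Explains T φ G) (hN : N.IsArborealNetwork) :
    G.IsArborealExplainable := by
  classical
  let e : X ≃ N.leaves := Equiv.ofBijective
    (fun x => ⟨φ x, (h.outdeg_eq_zero_iff _).2 ⟨x, rfl⟩⟩) (by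
      constructor
      · intro x y hxy
        exact h.injective (congrArg Subtype.val hxy)
      · rintro ⟨v, hv⟩
        obtain ⟨x, rfl⟩ := (h.outdeg_eq_zero_iff v).1 hv
        exact ⟨x, rfl⟩)
  refine ⟨V, inferInstance, N, fun u => if T u then 1 else 0, hN, ⟨⟨e, ?_⟩⟩⟩
  intro x y
  rw [explainedGraph_adj, h.adj_iff]
  refine lcaGraph_adj_congr fun u _ => ?_
  constructor
  · rintro ⟨_, hu⟩
    by_contra hT
    simp [hT] at hu
  · exact fun hT => ⟨h.two_le_outdeg u hT, by simp [hT]⟩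

section Step

variable [Finite V] {X : Type*} {G : SimpleGraph X} {x y : X} {T : V → Prop}
  {φ : ({y}ᶜ : Set X) → V}

open Classical in
/-- Extend a map on the complement of `y` to all vertices, moving the value at `x`. -/
noncomputable def extendLeaves {W : Type*} (x : X) (φ : ({y}ᶜ : Set X) → W) (a b : W) (z : X) : W :=
  if hy : z = y then b else if z = x then a else φ ⟨z, hy⟩

theorem extendLeaves_right {W : Type*} {φ : ({y}ᶜ : Set X) → W} {a b : W} :
    extendLeaves x φ a b y = b := by
  simp [extendLeaves]

theorem extendLeaves_left {W : Type*} {φ : ({y}ᶜ : Set X) → W} {a b : W} (hxy : x ≠ y) :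
    extendLeaves x φ a b x = a := by
  simp [extendLeaves, hxy]

theorem extendLeaves_of_ne {W : Type*} {φ : ({y}ᶜ : Set X) → W} {a b : W} {z : X} (hx : z ≠ x)
    (hy : z ≠ y) : extendLeaves x φ a b z = φ ⟨z, hy⟩ := by
  simp [extendLeaves, hx, hy]

/-- Bookkeeping shared by both extension steps: `a` and `b` become the leaves of `x` and `y`, while
the former leaf of `x` is free to become an interior vertex. -/
theorem explains_extendLeaves {W : Type*} {M : Digraph W} {T : W → Prop}
    {φ : ({y}ᶜ : Set X) → W} {a b : W} (hxy : x ≠ y) (hφ : Function.Injective φ) (hab : a ≠ b)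
    (ha : ∀ z, φ z ≠ a) (hb : ∀ z, φ z ≠ b)
    (hdeg : ∀ w, M.outdeg w = 0 ↔ w = a ∨ w = b ∨ ∃ z : ({y}ᶜ : Set X), (z : X) ≠ x ∧ φ z = w)
    (hT : ∀ w, T w → 2 ≤ M.outdeg w)
    (hbx : (M.lcaGraph T).Adj b a ↔ G.Adj y x)
    (hbz : ∀ z : ({y}ᶜ : Set X), (z : X) ≠ x → ((M.lcaGraph T).Adj b (φ z) ↔ G.Adj y z))
    (haz : ∀ z : ({y}ᶜ : Set X), (z : X) ≠ x → ((M.lcaGraph T).Adj a (φ z) ↔ G.Adj x z))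
    (hzz : ∀ z z' : ({y}ᶜ : Set X), (z : X) ≠ x → (z' : X) ≠ x →
      ((M.lcaGraph T).Adj (φ z) (φ z') ↔ G.Adj z z')) :
    M.Explains T (extendLeaves x φ a b) G where
  injective := by
    have hy : ∀ z, extendLeaves x φ a b z = b → z = y := by
      intro z hz
      by_contra hzy
      by_cases hzx : z = x
      · subst hzx
        exact hab ((extendLeaves_left hxy).symm.trans hz)
      · exact hb _ ((extendLeaves_of_ne hzx hzy).symm.trans hz)
    have hx : ∀ z, extendLeaves x φ a b z = a → z = x := by
      intro z hz
      by_contra hzx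
      by_cases hzy : z = y
      · subst hzy
        exact hab (hz.symm.trans extendLeaves_right)
      · exact ha _ ((extendLeaves_of_ne hzx hzy).symm.trans hz)
    intro z z' h
    by_cases hzy : z = y
    · subst hzy
      exact (hy z' (h.symm.trans extendLeaves_right)).symm
    by_cases hzx : z = x
    · subst hzx
      exact (hx z' (h.symm.trans (extendLeaves_left hxy))).symm
    by_cases hzy' : z' = y
    · subst hzy'
      exact hy z (h.trans extendLeaves_right)
    by_cases hzx' : z' = x
    · subst hzx'
      exact hx z (h.trans (extendLeaves_left hxy))
    rw [extendLeaves_of_ne hzx hzy, extendLeaves_of_ne hzx' hzy'] at h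
    exact congrArg Subtype.val (hφ h)
  outdeg_eq_zero_iff w := by
    rw [hdeg]
    constructor
    · rintro (rfl | rfl | ⟨z, hzx, rfl⟩)
      · exact ⟨x, extendLeaves_left hxy⟩
      · exact ⟨y, extendLeaves_right⟩
      · exact ⟨z, extendLeaves_of_ne hzx z.2⟩
    · rintro ⟨z, rfl⟩
      by_cases hzy : z = y
      · subst hzy; right; left; exact extendLeaves_right
      by_cases hzx : z = x
      · subst hzx; left; exact extendLeaves_left hxy
      · right; right; exact ⟨⟨z, hzy⟩, hzx, (extendLeaves_of_ne hzx hzy).symm⟩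
  adj_iff z z' := by
    have hy : ∀ z, G.Adj y z ↔ (M.lcaGraph T).Adj b (extendLeaves x φ a b z) := by
      intro z
      by_cases hzy : z = y
      · subst hzy
        rw [extendLeaves_right]
        exact iff_of_false (fun h => h.ne rfl) fun h => h.ne rfl
      by_cases hzx : z = x
      · subst hzx
        rw [extendLeaves_left hxy, hbx]
      · rw [extendLeaves_of_ne hzx hzy]
        exact (hbz ⟨z, hzy⟩ hzx).symm
    have hx : ∀ z, G.Adj x z ↔ (M.lcaGraph T).Adj a (extendLeaves x φ a b z) := by
      intro z
      by_cases hzy : z = y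
      · subst hzy
        rw [extendLeaves_right, G.adj_comm, ← hbx, SimpleGraph.adj_comm]
      by_cases hzx : z = x
      · subst hzx
        rw [extendLeaves_left hxy]
        exact iff_of_false (fun h => h.ne rfl) fun h => h.ne rfl
      · rw [extendLeaves_of_ne hzx hzy]
        exact (haz ⟨z, hzy⟩ hzx).symm
    by_cases hzy : z = y
    · subst hzy; rw [extendLeaves_right, hy]
    by_cases hzx : z = x
    · subst hzx; rw [extendLeaves_left hxy, hx]
    by_cases hzy' : z' = y
    · subst hzy'; rw [extendLeaves_right, G.adj_comm, hy, SimpleGraph.adj_comm]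
    by_cases hzx' : z' = x
    · subst hzx'; rw [extendLeaves_left hxy, G.adj_comm, hx, SimpleGraph.adj_comm]
    · rw [extendLeaves_of_ne hzx hzy, extendLeaves_of_ne hzx' hzy']
      exact (hzz ⟨z, hzy⟩ ⟨z', hzy'⟩ hzx hzx').symm
  two_le_outdeg := hT

-- The old leaf `l` becomes the parent of the leaves `some none` of `x` and `none` of `y`, labelled
-- by the adjacency of `x` and `y`. The degree conditions are required only away from `l`, so that a
-- single vertex, which is not a network, can serve as a start.
open Classical in
theorem Explains.exists_of_twin (hxy : x ≠ y) (hN : N.IsAcyclic)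
    (hT : N.toSimpleGraphInclusive.IsTree)
    (hroot : ∀ v, v ≠ φ ⟨x, hxy⟩ → N.indeg v = 0 → 2 ≤ N.outdeg v)
    (hleaf : ∀ v, v ≠ φ ⟨x, hxy⟩ → N.outdeg v = 0 → N.indeg v = 1)
    (hone : ∀ v, v ≠ φ ⟨x, hxy⟩ → ¬ (N.indeg v = 1 ∧ N.outdeg v = 1))
    (h : N.Explains T φ (G.induce {y}ᶜ))
    (htwin : ∀ z, z ≠ x → z ≠ y → (G.Adj y z ↔ G.Adj x z)) :
    ∃ (M : Digraph (Option (Option V))) (T' : Option (Option V) → Prop)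
      (ψ : X → Option (Option V)), M.IsArborealNetwork ∧ M.Explains T' ψ G := by
  obtain ⟨l, hl⟩ : ∃ l, l = φ ⟨x, hxy⟩ := ⟨_, rfl⟩
  rw [← hl] at hroot hleaf hone
  have hl0 : N.outdeg l = 0 := (h.outdeg_eq_zero_iff l).2 ⟨_, hl.symm⟩
  have hφl : ∀ z : ({y}ᶜ : Set X), (z : X) ≠ x → φ z ≠ l := by
    intro z hz he
    exact hz (congrArg Subtype.val (h.injective (he.trans hl)))
  have h1 := N.isLeafExtension_addChild l
  have h2 := (N.addChild l).isLeafExtension_addChild (some l)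
  set T' : Option (Option V) → Prop := fun w =>
    match w with
    | some (some u) => if u = l then G.Adj y x else T u
    | _ => False with hT'
  have hac1 := h1.isAcyclic_iff.2 hN
  have hac2 := h2.isAcyclic_iff.2 hac1
  have htree := h2.isTree_iff.2 (h1.isTree_iff.2 hT)
  refine ⟨(N.addChild l).addChild (some l), T',
    extendLeaves x (fun z => some (some (φ z))) (some none) none,
    ⟨⟨htree.connected, hac2, ?_, ?_, ?_⟩, htree⟩, ?_⟩
  · rintro (_ | _ | v) <;>
      simp only [outdeg_addChild_some, outdeg_addChild_none, indeg_addChild_some,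
        indeg_addChild_none, Option.some.injEq, reduceCtorEq, if_false]
    · simp
    · simp
    · have := hroot v
      by_cases hv : v = l
      · simp [hv]
      · simpa [hv] using this hv
  · rintro (_ | _ | v) <;>
      simp only [outdeg_addChild_some, outdeg_addChild_none, indeg_addChild_some,
        indeg_addChild_none, Option.some.injEq, reduceCtorEq, if_false]
    · simp
    · simp
    · by_cases hv : v = l
      · simp [hv]
      · simpa [hv] using hleaf v hv
  · rintro (_ | _ | v) <;>
      simp only [outdeg_addChild_some, outdeg_addChild_none, indeg_addChild_some,
        indeg_addChild_none, Option.some.injEq, reduceCtorEq, if_false]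
    · simp
    · simp
    · by_cases hv : v = l
      · simp [hv]
      · simpa [hv] using hone v hv
  have hold : ∀ v w, (∀ u, N.IsLCA u v w → u ≠ l) →
      ((((N.addChild l).addChild (some l)).lcaGraph T').Adj (some (some v)) (some (some w)) ↔
        (N.lcaGraph T).Adj v w) := by
    intro v w hvw
    rw [h2.lcaGraph_adj_iff, h1.lcaGraph_adj_iff]
    refine lcaGraph_adj_congr fun u hu => ?_
    simp [hT', hvw u hu]
  -- In `N` the vertex `l` is a sink, so its new label affects no old pair.
  have hlca : ∀ v w, w ≠ l → ∀ u, N.IsLCA u v w → u ≠ l := by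
    rintro v w hw u hu rfl
    exact hw ((IsLeafExtension.isAncestor_left_of_sink
      (not_adj_of_outdeg_eq_zero hl0)).1 hu.1.2).symm
  have hlz : ∀ z : ({y}ᶜ : Set X), (z : X) ≠ x → ((N.lcaGraph T).Adj l (φ z) ↔ G.Adj x z) := by
    intro z hz
    rw [hl, ← h.adj_iff]
    rfl
  have hnone : ∀ z : ({y}ᶜ : Set X), (z : X) ≠ x →
      ((((N.addChild l).addChild (some l)).lcaGraph T').Adj (some none) (some (some (φ z))) ↔
        G.Adj x z) := by
    intro z hz
    rw [h2.lcaGraph_adj_iff, h1.lcaGraph_adj_of_sink addChild_not_adj (by simp)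
      (by simpa using hφl z hz), ← h2.lcaGraph_adj_iff, hold _ _ (hlca _ _ (hφl z hz)), hlz z hz]
  apply explains_extendLeaves hxy
  · intro z z' hzz
    exact h.injective (by simpa using hzz)
  · simp
  · simp
  · simp
  · rintro (_ | _ | v) <;>
      simp only [outdeg_addChild_some, outdeg_addChild_none, Option.some.injEq, reduceCtorEq,
        if_false]
    · simp
    · simp
    · simp only [false_or]
      constructor
      · intro hv
        have hvl : v ≠ l := by
          rintro rfl
          simp at hv
        obtain ⟨z, rfl⟩ := (h.outdeg_eq_zero_iff v).1 (by omega)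
        refine ⟨z, ?_, rfl⟩
        rintro rfl
        exact hvl hl.symm
      · rintro ⟨z, hz, rfl⟩
        simp [hφl z hz, (h.outdeg_eq_zero_iff _).2 ⟨z, rfl⟩]
  · rintro (_ | _ | v) hv
    · exact hv.elim
    · exact hv.elim
    · simp only [outdeg_addChild_some, Option.some.injEq]
      by_cases hvl : v = l
      · simp [hvl]
      · simp only [hT', hvl, if_false] at hv
        have := h.two_le_outdeg v hv
        omega
  · rw [h2.lcaGraph_adj_of_sink addChild_not_adj (by simp) (by simp), SimpleGraph.adj_comm,
      h2.lcaGraph_adj_iff, h1.lcaGraph_adj_parent_of_sink hac1 addChild_not_adj]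
    simp [hT']
  · intro z hz
    rw [h2.lcaGraph_adj_of_sink addChild_not_adj (by simp) (by simpa using hφl z hz),
      hold _ _ (hlca _ _ (hφl z hz)), hlz z hz, htwin z hz z.2]
  · exact hnone
  · intro z z' hz hz'
    rw [hold _ _ (hlca _ _ (hφl z' hz')), ← h.adj_iff]
    rfl

-- The new root `some none` has the children `l` and `none`, the leaf of `y`; its label records
-- whether `y` is pendant or isolated. The leaf of `x` is `some (some none)`, below `l`. The extra
-- parent gives `l` indegree two, which permits its outdegree one.
open Classical in
theorem Explains.exists_of_pendant (hxy : x ≠ y) (hN : N.IsArborealNetwork)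
    (h : N.Explains T φ (G.induce {y}ᶜ)) (hpend : ∀ z, z ≠ x → ¬ G.Adj y z) :
    ∃ (M : Digraph (Option (Option (Option V)))) (T' : Option (Option (Option V)) → Prop)
      (ψ : X → Option (Option (Option V))), M.IsArborealNetwork ∧ M.Explains T' ψ G := by
  obtain ⟨l, hl⟩ : ∃ l, l = φ ⟨x, hxy⟩ := ⟨_, rfl⟩
  have hl0 : N.outdeg l = 0 := (h.outdeg_eq_zero_iff l).2 ⟨_, hl.symm⟩
  have hφl : ∀ z : ({y}ᶜ : Set X), (z : X) ≠ x → φ z ≠ l := by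
    intro z hz he
    exact hz (congrArg Subtype.val (h.injective (he.trans hl)))
  have hl1 := hN.indeg_of_leaf l hl0
  have h1 := N.isLeafExtension_addChild l
  have h2 := (N.addChild l).isLeafExtension_addParent (some l)
  have h3 := ((N.addChild l).addParent (some l)).isLeafExtension_addChild none
  set M := ((N.addChild l).addParent (some l)).addChild none with hM
  set T' : Option (Option (Option V)) → Prop := fun w =>
    match w with
    | some (some (some u)) => T u
    | some none => G.Adj y x
    | _ => False with hT'
  have hac3 := h3.isAcyclic_iff.2 (h2.isAcyclic_iff.2 (h1.isAcyclic_iff.2 hN.acyclic))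
  have htree := h3.isTree_iff.2 (h2.isTree_iff.2 (h1.isTree_iff.2 hN.isTree))
  refine ⟨M, T', extendLeaves x (fun z => some (some (some (φ z)))) (some (some none)) none,
    ⟨⟨htree.connected, hac3, ?_, ?_, ?_⟩, htree⟩, ?_⟩
  · rintro (_ | _ | _ | v) <;>
      simp only [hM, outdeg_addChild_some, outdeg_addChild_none, indeg_addChild_some,
        indeg_addChild_none, outdeg_addParent_some, outdeg_addParent_none, indeg_addParent_some,
        indeg_addParent_none, Option.some.injEq, reduceCtorEq, if_false, if_true]
    · simp
    · simp
    · simp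
    · have := hN.two_le_outdeg_of_root v
      omega
  · rintro (_ | _ | _ | v) <;>
      simp only [hM, outdeg_addChild_some, outdeg_addChild_none, indeg_addChild_some,
        indeg_addChild_none, outdeg_addParent_some, outdeg_addParent_none, indeg_addParent_some,
        indeg_addParent_none, Option.some.injEq, reduceCtorEq, if_false, if_true]
    · simp
    · simp
    · simp
    · have := hN.indeg_of_leaf v
      by_cases hv : v = l
      · simp [hv]
      · simpa [hv] using this
  · rintro (_ | _ | _ | v) <;>
      simp only [hM, outdeg_addChild_some, outdeg_addChild_none, indeg_addChild_some,
        indeg_addChild_none, outdeg_addParent_some, outdeg_addParent_none, indeg_addParent_some,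
        indeg_addParent_none, Option.some.injEq, reduceCtorEq, if_false, if_true]
    · simp
    · simp
    · simp
    · have := hN.not_one_one v
      by_cases hv : v = l
      · simp [hv, hl1]
      · simpa [hv] using this
  have hold : ∀ v w, (M.lcaGraph T').Adj (some (some (some v))) (some (some (some w))) ↔
      (N.lcaGraph T).Adj v w := by
    intro v w
    rw [h3.lcaGraph_adj_iff, h2.lcaGraph_adj_iff, h1.lcaGraph_adj_iff]
    rfl
  have hlz : ∀ z : ({y}ᶜ : Set X), (N.lcaGraph T).Adj l (φ z) ↔ G.Adj x z := by
    intro z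
    rw [hl, ← h.adj_iff]
    rfl
  -- The leaf of `y` is a twin of the root, which has only the descendants of `l` on its other side.
  have hy : ∀ w, (M.lcaGraph T').Adj none (some (some w)) ↔
      G.Adj y x ∧ (N.addChild l).IsAncestor (some l) w := by
    intro w
    rw [h3.lcaGraph_adj_of_sink addChild_not_adj (by simp) (by simp), h3.lcaGraph_adj_iff,
      h2.lcaGraph_adj_of_source addParent_not_adj, h2.isAncestor_iff]
    rfl
  apply explains_extendLeaves hxy
  · intro z z' hzz
    exact h.injective (by simpa using hzz)
  · simp
  · simp
  · simp
  · rintro (_ | _ | _ | v) <;>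
      simp only [hM, outdeg_addChild_some, outdeg_addChild_none, outdeg_addParent_some,
        outdeg_addParent_none, Option.some.injEq, reduceCtorEq, if_false, if_true]
    · simp
    · simp
    · simp
    · simp only [false_or]
      constructor
      · intro hv
        have hvl : v ≠ l := by
          rintro rfl
          simp at hv
        obtain ⟨z, rfl⟩ := (h.outdeg_eq_zero_iff v).1 (by omega)
        refine ⟨z, ?_, rfl⟩
        rintro rfl
        exact hvl hl.symm
      · rintro ⟨z, hz, rfl⟩
        simp [hφl z hz, (h.outdeg_eq_zero_iff _).2 ⟨z, rfl⟩]
  · rintro (_ | _ | _ | v) hv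
    · exact hv.elim
    · simp [hM, outdeg_addChild_some, outdeg_addParent_none]
    · exact hv.elim
    · simp only [hM, outdeg_addChild_some, outdeg_addParent_some]
      have := h.two_le_outdeg v hv
      omega
  · rw [hy]
    exact and_iff_left (.single rfl)
  · intro z hz
    rw [hy, h1.isAncestor_iff, IsLeafExtension.isAncestor_left_of_sink
      (not_adj_of_outdeg_eq_zero hl0)]
    exact iff_of_false (fun h => hφl z hz h.2.symm) (hpend z hz)
  · intro z hz
    rw [h3.lcaGraph_adj_iff, h2.lcaGraph_adj_iff, h1.lcaGraph_adj_of_sink addChild_not_adj (by simp)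
      (by simpa using hφl z hz), ← h2.lcaGraph_adj_iff, ← h3.lcaGraph_adj_iff, hold, hlz z]
  · intro z z' hz hz'
    rw [hold, ← h.adj_iff]
    rfl

end Step

end Digraph

/-! ### Induction on the number of vertices -/

theorem SimpleGraph.IsWalkHereditary.exists_explains {X : Type u} [Finite X] {G : SimpleGraph X}
    (hG : G.IsWalkHereditary) (hX : 2 ≤ Nat.card X) :
    ∃ (V : Type u) (_ : Finite V) (N : Digraph V) (T : V → Prop) (φ : X → V),
      N.IsArborealNetwork ∧ N.Explains T φ G := by
  obtain ⟨n, hn⟩ := Nat.exists_eq_add_of_le hX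
  induction n generalizing X with
  | zero =>
    have : Nontrivial X := Finite.one_lt_card_iff_nontrivial.1 (by omega)
    obtain ⟨x, y, hxy⟩ := exists_pair_ne X
    have huniv : ∀ z, z = x ∨ z = y := by
      intro z
      by_contra! hz
      have h3 : ({z, x, y} : Set X).ncard = 3 :=
        Set.ncard_eq_three.2 ⟨z, x, y, hz.1, hz.2, hxy, rfl⟩
      have := Set.ncard_le_card ({z, x, y} : Set X)
      omega
    have hsub : Subsingleton ({y}ᶜ : Set X) := ⟨fun a b => Subtype.ext
      (((huniv a).resolve_right a.2).trans ((huniv b).resolve_right b.2).symm)⟩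
    -- With two vertices, the twin step applied to a single vertex gives a root with two leaves; the
    -- twin condition is vacuous.
    let N : Digraph PUnit.{u + 1} := ⟨fun _ _ => False⟩
    have hdeg : ∀ v, N.outdeg v = 0 := fun v => by simp [Digraph.outdeg, N]
    have hac : N.IsAcyclic := fun v hv => by
      obtain ⟨w, hw, -⟩ := Relation.TransGen.head'_iff.1 hv
      exact hw
    have hexp : N.Explains (fun _ => False) (fun _ => PUnit.unit) (G.induce {y}ᶜ) :=
      { injective := fun a b _ => Subsingleton.elim a b
        outdeg_eq_zero_iff := fun v => iff_of_true (hdeg v) ⟨⟨x, hxy⟩, rfl⟩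
        adj_iff := fun a b => iff_of_false (fun h => h.ne (Subsingleton.elim a b))
          fun h => h.ne rfl
        two_le_outdeg := fun _ => False.elim }
    obtain ⟨M, T', ψ, h⟩ := hexp.exists_of_twin hxy hac SimpleGraph.IsTree.of_subsingleton
      (fun v hv => absurd rfl hv) (fun v hv => absurd rfl hv) (fun v hv => absurd rfl hv)
      (fun z h1 h2 => ((huniv z).elim h1 h2).elim)
    exact ⟨_, inferInstance, M, T', ψ, h⟩
  | succ n ih =>
    have : Nontrivial X := Finite.one_lt_card_iff_nontrivial.1 (by omega)
    obtain ⟨x, y, hxy, h⟩ := hG.exists_isTwinOrPendant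
    have hcard : Nat.card ({y}ᶜ : Set X) = 2 + n := by
      have := Set.ncard_add_ncard_compl ({y} : Set X)
      rw [Set.ncard_singleton] at this
      rw [Nat.card_coe_set_eq]
      omega
    obtain ⟨V, _, N, T, φ, hN, hexp⟩ := ih (hG.of_embedding (SimpleGraph.Embedding.induce {y}ᶜ))
      (by omega) hcard
    rcases h with h | h
    · obtain ⟨M, T', ψ, h⟩ := hexp.exists_of_twin hxy hN.acyclic hN.isTree
        (fun v _ => hN.two_le_outdeg_of_root v) (fun v _ => hN.indeg_of_leaf v)
        (fun v _ => hN.not_one_one v) h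
      exact ⟨_, inferInstance, M, T', ψ, h⟩
    · obtain ⟨M, T', ψ, h⟩ := hexp.exists_of_pendant hxy hN h
      exact ⟨_, inferInstance, M, T', ψ, h⟩

theorem mainTheorem1 {X : Type u} [Finite X] (hX : 2 ≤ Nat.card X) (G : SimpleGraph X) :
    G.IsArborealExplainable ↔ G.IsDistanceHereditary := by
  rw [SimpleGraph.isDistanceHereditary_iff_isWalkHereditary]
  refine ⟨fun h => h.isWalkHereditary, fun h => ?_⟩
  obtain ⟨V, _, N, T, φ, hN, hexp⟩ := h.exists_explains hX
  exact hexp.isArborealExplainable hN
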